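/- Let $\lambda_1,\dots,\lambda_8$ be the Gell-Mann matrices and let $L_a$ be the elements of the complexified enveloping algebra $\mathcal U=\mathbb C\otimes_{\mathbb R}U(\mathfrak{su}(3))$ such that $iL_a$ is the element $i\lambda_a$ of $\mathfrak{su}(3)$. Call an element of $\mathcal U$ \emph{cubic} if it is a sum of products of one, two or three elements of the Lie algebra (filtration degree at most $3$, no constant term), and say that it commutes with $\mathrm U(2)$ if it commutes with $L_1,L_2,L_3,L_8$. Let $\dagger$ be the conjugate-linear anti-automorphism of $\mathcal U$ with $L_a^\dagger=L_a$. For parameters $\alpha,\beta,\gamma$ and $A,B,C,U,V$ put $$\Omega_2^{\mathrm U(2)}=\tfrac1{12}\Big(\alpha\,(L_1^2+L_2^2+L_3^2)+\beta\,(L_4^2+L_5^2+L_6^2+L_7^2)+\gamma\,L_8^2\Big),$$ $$\begin{aligned}\Omega_3^{\mathrm U(2)}=\tfrac1{72}\Big(&6\sqrt3\,A\,(L_1^2+L_2^2+L_3^2)L_8-3\sqrt3\,B\,(L_4^2+L_5^2+L_6^2+L_7^2)L_8-2\sqrt3\,C\,L_8^3\\&+9\,U\,(2L_1L_4L_6+2L_1L_5L_7-2L_2L_4L_7+2L_2L_5L_6+L_3L_4^2+L_3L_5^2-L_3L_6^2-L_3L_7^2+4L_3)-12\sqrt3\,V\,L_8\Big).\end{aligned}$$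 (1) An element of $\mathcal U$ is cubic and commutes with $\mathrm U(2)$ if and only if it is equal to $\Omega_3^{\mathrm U(2)}+9x\,\Omega_2^{\mathrm U(2)}$ for some complex numbers $A,B,C,U,V,x,\alpha,\beta,\gamma$. It is moreover self-adjoint, $z^\dagger=z$, if and only if it is of this form with real $A,B,C,U,V,x,\alpha,\beta,\gamma$. (2) Let $E$ be a finite-dimensional irreducible complex representation of $\mathfrak{su}(3)$ with highest weight of Dynkin components $(o_1,o_2)$, relative to the coroots $h_1=L_3$, $h_2=\tfrac12(-L_3+\sqrt3L_8)$ and the raising operators $\tfrac12(L_1+iL_2)$, $\tfrac12(L_6+iL_7)$. Let $W\subseteq E$ be an irreducible $\mathrm U(2)$-subrepresentation (for the generators $L_1,L_2,L_3,L_8$) of isospin $I$ and hypercharge $Y$, i.e. with $\mathrm{SU}(2)$ highest weight $2I$ (the eigenvalue of $L_3$ on a highest weight vector) and with $\sqrt3L_8$ acting as $3Y$. Then, for all complex $A,B,C,U,V$, the element $\Omega_3^{\mathrm U(2)}$ acts on $W$ as the scalar $$U\,C_3+\big(U_B\,C_2+U_{AB}\,I(I+1)+U_{BC}\,Y^2\big)\,Y+U_V\,Y,$$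 where $U_B=\tfrac32(U-B)$, $U_{AB}=\tfrac12(2A+B-3U)$, $U_{BC}=\tfrac18(3B-2C-U)$, $U_V=\tfrac12(U-V)$, and $$C_2=\tfrac16\Big(\tfrac23(o_1^2+o_1o_2+o_2^2)+2(o_1+o_2)\Big),\qquad C_3=\tfrac1{27}(o_1-o_2)(3+2o_1+o_2)(3+o_1+2o_2).$$ -/

import Mathlib

open scoped TensorProduct

-- The commutator bracket on an associative ring.
attribute [local instance] LieRing.ofAssociativeRing

namespace SU3

noncomputable section

/-- The real Lie algebra `su(3)` of traceless anti-Hermitian `3 × 3` matrices. -/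
def su3 : LieSubalgebra ℝ (Matrix (Fin 3) (Fin 3) ℂ) where
  carrier := {X | X.conjTranspose = -X ∧ X.trace = 0}
  add_mem' := by
    rintro X Y ⟨hX, hX'⟩ ⟨hY, hY'⟩
    refine ⟨?_, ?_⟩
    · rw [Matrix.conjTranspose_add, hX, hY, neg_add]
    · rw [Matrix.trace_add, hX', hY', add_zero]
  zero_mem' := by simp
  smul_mem' := by
    rintro c X ⟨hX, hX'⟩
    refine ⟨?_, ?_⟩
    · rw [Matrix.conjTranspose_smul, hX, star_trivial, smul_neg]
    · rw [Matrix.trace_smul, hX', smul_zero]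
  lie_mem' := by
    rintro X Y ⟨hX, hX'⟩ ⟨hY, hY'⟩
    refine ⟨?_, ?_⟩
    · rw [LieRing.of_associative_ring_bracket, Matrix.conjTranspose_sub,
        Matrix.conjTranspose_mul, Matrix.conjTranspose_mul, hX, hY]
      simp
    · rw [LieRing.of_associative_ring_bracket, Matrix.trace_sub, Matrix.trace_mul_comm, sub_self]

/-- The Gell-Mann matrices `λ₁, …, λ₈` (and `0` for every other index). -/
def gellMann : ℕ → Matrix (Fin 3) (Fin 3) ℂ
  | 1 => !![0, 1, 0; 1, 0, 0; 0, 0, 0]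
  | 2 => !![0, -Complex.I, 0; Complex.I, 0, 0; 0, 0, 0]
  | 3 => !![1, 0, 0; 0, -1, 0; 0, 0, 0]
  | 4 => !![0, 0, 1; 0, 0, 0; 1, 0, 0]
  | 5 => !![0, 0, -Complex.I; 0, 0, 0; Complex.I, 0, 0]
  | 6 => !![0, 0, 0; 0, 0, 1; 0, 1, 0]
  | 7 => !![0, 0, 0; 0, 0, -Complex.I; 0, Complex.I, 0]
  | 8 => (((√3 : ℝ) : ℂ)⁻¹) • !![1, 0, 0; 0, 1, 0; 0, 0, -2]
  | _ => 0

theorem gellMann_conjTranspose (a : ℕ) : (gellMann a).conjTranspose = gellMann a := by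
  unfold gellMann
  split <;> (ext i j; fin_cases i <;> fin_cases j <;> simp)

theorem gellMann_trace (a : ℕ) : (gellMann a).trace = 0 := by
  unfold gellMann
  split <;> simp [Matrix.trace_fin_three]
  ring

/-- The element `i λ_a` of `su(3)`. -/
def iGellMann (a : ℕ) : su3 :=
  ⟨Complex.I • gellMann a, by
    refine ⟨?_, ?_⟩
    · rw [Matrix.conjTranspose_smul, gellMann_conjTranspose]
      simp
    · rw [Matrix.trace_smul, gellMann_trace, smul_zero]⟩

/-- The enveloping algebra of `su(3)` with complex coefficients. -/
abbrev Env : Type := ℂ ⊗[ℝ] UniversalEnvelopingAlgebra ℝ su3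

/-- The inclusion of `su(3)` into its enveloping algebra. -/
def incl (X : su3) : Env := 1 ⊗ₜ[ℝ] UniversalEnvelopingAlgebra.ι ℝ X

/-- The Hermitian generators `L_a`, characterised by `i L_a = i λ_a ∈ su(3)`. -/
def L (a : ℕ) : Env := (-Complex.I) • incl (iGellMann a)

/-- The complex span of `su(3)` in the enveloping algebra. -/
def generators : Submodule ℂ Env := Submodule.span ℂ (Set.range incl)

/-- Cubic elements: the sums of products of one, two or three Lie algebra elements,
that is, the elements of filtration degree at most three without constant term. -/
def cubicElements : Submodule ℂ Env := generators ⊔ generators ^ 2 ⊔ generators ^ 3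

/-- The generators of `Lie(U(2)) = su(2) ⊕ u(1)` are `L₁, L₂, L₃` and `L₈`. -/
def u2Indices : Set ℕ := {1, 2, 3, 8}

/-- `z` commutes with the generators of `U(2)`. -/
def CommutesWithU2 (z : Env) : Prop := ∀ a ∈ u2Indices, L a * z = z * L a

/-- The Lie algebra homomorphism `X ↦ -X` into the opposite of the enveloping algebra. -/
def negOp : su3 →ₗ⁅ℝ⁆ (UniversalEnvelopingAlgebra ℝ su3)ᵐᵒᵖ where
  toFun X := MulOpposite.op (-(UniversalEnvelopingAlgebra.ι ℝ X))
  map_add' X Y := by rw [map_add, neg_add, MulOpposite.op_add]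
  map_smul' c X := by rw [map_smul, ← smul_neg, MulOpposite.op_smul, RingHom.id_apply]
  map_lie' {X Y} := by
    rw [LieHom.map_lie, LieRing.of_associative_ring_bracket, LieRing.of_associative_ring_bracket,
      ← MulOpposite.op_mul, ← MulOpposite.op_mul, ← MulOpposite.op_sub]
    simp

/-- The principal anti-automorphism of the real enveloping algebra,
the one with `X ↦ -X` for `X ∈ su(3)`. -/
def antipode : UniversalEnvelopingAlgebra ℝ su3 →ₗ[ℝ] UniversalEnvelopingAlgebra ℝ su3 :=
  (MulOpposite.opLinearEquiv ℝ).symm.toLinearMap ∘ₗ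
    (UniversalEnvelopingAlgebra.lift ℝ negOp).toLinearMap

/-- The formal adjoint `z ↦ z†`: the conjugate-linear anti-automorphism of the enveloping algebra
with `X† = -X` for `X ∈ su(3)`, that is, with `L_a† = L_a`. -/
def adjoint : Env →ₗ[ℝ] Env := TensorProduct.map Complex.conjAe.toLinearMap antipode

/-- The modified quadratic Casimir element, minus the Laplacian of the left-invariant metric whose
inverse is `diag(α, α, α, β, β, β, β, γ)` in the Killing-orthonormal basis `i L_a / (2 √3)`. -/
def Omega2 (α β γ : ℂ) : Env :=
  (1 / 12 : ℂ) •
    (α • (L 1 * L 1 + L 2 * L 2 + L 3 * L 3) +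
      β • (L 4 * L 4 + L 5 * L 5 + L 6 * L 6 + L 7 * L 7) +
      γ • (L 8 * L 8))

/-- The modified cubic Casimir element. -/
def Omega3 (A B C U V : ℂ) : Env :=
  (1 / 72 : ℂ) •
    ((6 * ((√3 : ℝ) : ℂ) * A) • (L 1 * L 1 * L 8 + L 2 * L 2 * L 8 + L 3 * L 3 * L 8) -
      (3 * ((√3 : ℝ) : ℂ) * B) •
        (L 4 * L 4 * L 8 + L 5 * L 5 * L 8 + L 6 * L 6 * L 8 + L 7 * L 7 * L 8) -
      (2 * ((√3 : ℝ) : ℂ) * C) • (L 8 * L 8 * L 8) +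
      (9 * U) •
        ((2 : ℂ) • (L 1 * L 4 * L 6) + (2 : ℂ) • (L 1 * L 5 * L 7) -
          (2 : ℂ) • (L 2 * L 4 * L 7) + (2 : ℂ) • (L 2 * L 5 * L 6) +
          L 3 * L 4 * L 4 + L 3 * L 5 * L 5 - L 3 * L 6 * L 6 - L 3 * L 7 * L 7 +
          (4 : ℂ) • L 3) -
      (12 * V * ((√3 : ℝ) : ℂ)) • L 8)

section Representations

variable {E : Type*} [AddCommGroup E] [Module ℂ E]

theorem act_commute (ρ : su3 →ₗ⁅ℝ⁆ Module.End ℂ E) (c : ℂ)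
    (u : UniversalEnvelopingAlgebra ℝ su3) :
    Commute (Algebra.ofId ℂ (Module.End ℂ E) c) (UniversalEnvelopingAlgebra.lift ℝ ρ u) :=
  Algebra.commutes c _

/-- The action on `E` of the complex enveloping algebra that extends a complex representation `ρ`
of `su(3)`. -/
def act (ρ : su3 →ₗ⁅ℝ⁆ Module.End ℂ E) : Env →ₐ[ℂ] Module.End ℂ E :=
  Algebra.TensorProduct.lift (Algebra.ofId ℂ (Module.End ℂ E))
    (UniversalEnvelopingAlgebra.lift ℝ ρ) (act_commute ρ)

/-- The operator `L_{jk} = (L_j + i L_k) / 2`. The raising operators of the two simple roots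
are `L₁₂` and `L₆₇`. -/
def ladder (j k : ℕ) : Env := (1 / 2 : ℂ) • (L j + Complex.I • L k)

/-- The simple coroot `h₁`. -/
def h1 : Env := L 3

/-- The simple coroot `h₂`. -/
def h2 : Env := (1 / 2 : ℂ) • (-L 3 + ((√3 : ℝ) : ℂ) • L 8)

/-- `ρ` is irreducible, with highest weight of Dynkin components `(o₁, o₂)`. -/
structure IsIrrep (ρ : su3 →ₗ⁅ℝ⁆ Module.End ℂ E) (o₁ o₂ : ℕ) : Prop where
  irreducible : ∀ S : Submodule ℂ E, (∀ X, ∀ v ∈ S, ρ X v ∈ S) → S = ⊥ ∨ S = ⊤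
  highest : ∃ v : E, v ≠ 0 ∧
    act ρ (ladder 1 2) v = 0 ∧ act ρ (ladder 6 7) v = 0 ∧
    act ρ h1 v = (o₁ : ℂ) • v ∧ act ρ h2 v = (o₂ : ℂ) • v

/-- The subspace `S` is stable under the generators of `U(2)`. -/
def IsU2Stable (ρ : su3 →ₗ⁅ℝ⁆ Module.End ℂ E) (S : Submodule ℂ E) : Prop :=
  ∀ a ∈ u2Indices, ∀ v ∈ S, act ρ (L a) v ∈ S

/-- `W` is an irreducible `U(2)`-subrepresentation of isospin `I` and hypercharge `Y`: its
`SU(2)` highest weight is `2I` and its `U(1)` weight, the eigenvalue of `√3 L₈`, is `3Y`. -/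
structure IsU2Component (ρ : su3 →ₗ⁅ℝ⁆ Module.End ℂ E) (W : Submodule ℂ E) (I Y : ℝ) : Prop where
  stable : IsU2Stable ρ W
  irreducible : ∀ S : Submodule ℂ E, S ≤ W → IsU2Stable ρ S → S = ⊥ ∨ S = W
  highest : ∃ w ∈ W, w ≠ 0 ∧ act ρ (ladder 1 2) w = 0 ∧
    act ρ (L 3) w = (2 * I : ℂ) • w ∧
    act ρ (((√3 : ℝ) : ℂ) • L 8) w = (3 * Y : ℂ) • w

end Representations

/-- The eigenvalue of the quadratic Casimir element of the Killing form. -/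
def C2 (o₁ o₂ : ℕ) : ℂ :=
  ((2 / 3 : ℂ) * ((o₁ : ℂ) ^ 2 + o₁ * o₂ + (o₂ : ℂ) ^ 2) + 2 * ((o₁ : ℂ) + o₂)) / 6

/-- The eigenvalue of the undeformed cubic Casimir element. -/
def C3 (o₁ o₂ : ℕ) : ℂ :=
  (1 / 27 : ℂ) * ((o₁ : ℂ) - o₂) * (3 + 2 * (o₁ : ℂ) + o₂) * (3 + (o₁ : ℂ) + 2 * o₂)

end

end SU3

/-! The inclusion of su(3) extends complex-linearly to all 3 × 3 matrices, with the identity matrix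
sent to 0. The images `unit i j` of the matrix units satisfy the gl(3) relations and have trace
zero, and `IsMatrixUnits` abstracts exactly this, so all computations take place in an arbitrary
algebra with such elements. Only spanning statements are needed; no linear independence of monomials
is ever used.

Classification. Modulo lower degree, products can be reordered, so cubic elements are combinations
of ordered monomials. Commuting with the diagonal torus leaves the twenty monomials of weight zero.
On these, ad(e₁₀) ad(e₀₁) is the SU(2) Casimir operator, with eigenvalues j(j+1) = 0, 2, 6, 12. The
span of the monomials is covered by eight explicit invariants together with explicit eigenvectors of
nonzero eigenvalue (`span_zeroWeightMonomials_le`). Since eigenspaces are independent, an element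
annihilated by the operator lies in the span of the eight invariants. An invertible change of
coordinates, after setting x = 1, turns these coefficients into the parameters of Ω₃ and Ω₂.

Self-adjointness. Each of the eight invariants is fixed by †, so averaging z with z† replaces the
coefficients by their real parts.

Eigenvalues. Ω₃ is a combination of the cubic Casimir element and of products with e₂₂ of the
quadratic Casimir element, the isospin Casimir element and powers of e₂₂ (`Omega3_eq_casimir`). The
first two Casimir elements are central and are evaluated on the highest weight vector of E. The
isospin Casimir element and e₂₂ commute with U(2) and are evaluated on the highest weight vector of
W. -/

namespace SU3

noncomputable section

/-! ### Complexifying the inclusion of su(3) -/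

/-- The traceless anti-Hermitian part of a matrix. -/
def antiHermitianPart : Matrix (Fin 3) (Fin 3) ℂ →ₗ[ℝ] su3 where
  toFun M := ⟨(1 / 2 : ℂ) • (M - M.conjTranspose)
      - ((1 / 6 : ℂ) * (M - M.conjTranspose).trace) • (1 : Matrix (Fin 3) (Fin 3) ℂ), by
    refine ⟨?_, ?_⟩
    · rw [Matrix.conjTranspose_sub, Matrix.conjTranspose_smul, Matrix.conjTranspose_smul,
        Matrix.conjTranspose_sub, Matrix.conjTranspose_conjTranspose, Matrix.conjTranspose_one,
        star_mul', ← Matrix.trace_conjTranspose, Matrix.conjTranspose_sub,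
        Matrix.conjTranspose_conjTranspose, Matrix.trace_sub, Matrix.trace_sub]
      simp only [star_div₀, star_one, star_ofNat]
      module
    · rw [Matrix.trace_sub, Matrix.trace_smul, Matrix.trace_smul, Matrix.trace_one]
      simp
      ring⟩
  map_add' M N := by
    apply Subtype.ext
    simp only [Matrix.conjTranspose_add, AddMemClass.coe_add, Matrix.trace_sub, Matrix.trace_add]
    module
  map_smul' c M := by
    apply Subtype.ext
    simp only [Matrix.conjTranspose_smul, SetLike.val_smul, Matrix.trace_sub,
      Matrix.trace_smul, Complex.star_def, Complex.conj_ofReal, RingHom.id_apply, ← Complex.coe_smul]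
    module

theorem antiHermitianPart_coe (X : su3) : antiHermitianPart X = X := by
  apply Subtype.ext
  have h := X.2
  simp only [antiHermitianPart, LinearMap.coe_mk, AddHom.coe_mk]
  rw [show (X : Matrix (Fin 3) (Fin 3) ℂ).conjTranspose = -X from h.1, sub_neg_eq_add,
    Matrix.trace_add, show (X : Matrix (Fin 3) (Fin 3) ℂ).trace = 0 from h.2]
  module

theorem antiHermitianPart_conjTranspose (M : Matrix (Fin 3) (Fin 3) ℂ) :
    antiHermitianPart M.conjTranspose = -antiHermitianPart M := by
  apply Subtype.ext
  simp only [antiHermitianPart, LinearMap.coe_mk, AddHom.coe_mk,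
    Matrix.conjTranspose_conjTranspose, NegMemClass.coe_neg, Matrix.trace_sub]
  module

theorem antiHermitianPart_eq_zero {M : Matrix (Fin 3) (Fin 3) ℂ} (h : M.conjTranspose = M) :
    antiHermitianPart M = 0 := by
  apply Subtype.ext
  simp only [antiHermitianPart, LinearMap.coe_mk, AddHom.coe_mk, h, sub_self, Matrix.trace_zero,
    mul_zero, smul_zero, zero_smul]
  rfl

/-- This is the decomposition gl(3, ℂ) = su(3) ⊕ i su(3) ⊕ ℂ. It lets bilinear identities for
complex matrices be checked on su(3). -/
theorem eq_antiHermitianPart_add (M : Matrix (Fin 3) (Fin 3) ℂ) :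
    M = antiHermitianPart M +
      Complex.I • (antiHermitianPart (-Complex.I • M) : Matrix (Fin 3) (Fin 3) ℂ) +
      (M.trace / 3) • (1 : Matrix (Fin 3) (Fin 3) ℂ) := by
  simp only [antiHermitianPart, LinearMap.coe_mk, AddHom.coe_mk, Matrix.conjTranspose_smul,
    Matrix.trace_sub, Matrix.trace_smul, smul_eq_mul, Complex.star_def, map_neg, Complex.conj_I]
  match_scalars <;> ring_nf <;> (simp only [Complex.I_sq]; ring)

/-- The inclusion of `su(3)` as a real linear map. -/
def inclₗ : su3 →ₗ[ℝ] Env where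
  toFun := incl
  map_add' X Y := by simp [incl, TensorProduct.tmul_add]
  map_smul' c X := by simp [incl]

theorem incl_lie (X Y : su3) : incl ⁅X, Y⁆ = incl X * incl Y - incl Y * incl X := by
  simp [incl, LieRing.of_associative_ring_bracket, TensorProduct.tmul_sub]

theorem env_real_smul (r : ℝ) (z : Env) : r • z = (r : ℂ) • z := by
  induction z using TensorProduct.induction_on with
  | zero => simp
  | add x y hx hy => rw [smul_add, smul_add, hx, hy]
  | tmul d v => simp [TensorProduct.smul_tmul']

/-- The complex linear extension of the inclusion of `su(3)`, vanishing on scalar matrices. -/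
def complexIncl : Matrix (Fin 3) (Fin 3) ℂ →ₗ[ℂ] Env where
  toFun M := incl (antiHermitianPart M) + Complex.I • incl (antiHermitianPart (-Complex.I • M))
  map_add' M N := by
    change inclₗ _ + Complex.I • inclₗ _ =
      inclₗ _ + Complex.I • inclₗ _ + (inclₗ _ + Complex.I • inclₗ _)
    simp only [smul_add, map_add]
    abel
  map_smul' c M := by
    change inclₗ _ + Complex.I • inclₗ _ = c • (inclₗ _ + Complex.I • inclₗ _)
    -- The anti-Hermitian part is only real linear, so `c` is split into real and imaginary parts,
    -- with `M` and `-i M` as the two vectors.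
    have h1 : c • M = c.re • M + (-c.im) • (-Complex.I • M) := by
      rw [← Complex.coe_smul, ← Complex.coe_smul, smul_smul, ← add_smul]
      congr 1
      push_cast
      linear_combination -(Complex.re_add_im c)
    have h2 : -Complex.I • c • M = c.re • (-Complex.I • M) + c.im • M := by
      rw [← Complex.coe_smul, ← Complex.coe_smul, smul_smul, smul_smul, ← add_smul]
      congr 1
      linear_combination Complex.I * (Complex.re_add_im c) - Complex.im c * Complex.I_sq
    rw [h2, h1]
    simp only [map_add, map_smul, env_real_smul]
    match_scalars
    · linear_combination Complex.re_add_im c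
    · linear_combination Complex.I * (Complex.re_add_im c) - Complex.im c * Complex.I_sq

theorem complexIncl_coe (X : su3) : complexIncl X = incl X := by
  change incl _ + Complex.I • incl _ = _
  rw [antiHermitianPart_coe, antiHermitianPart_eq_zero]
  · change _ + Complex.I • inclₗ 0 = _
    simp
  · rw [Matrix.conjTranspose_smul, show (X : Matrix (Fin 3) (Fin 3) ℂ).conjTranspose = -X from X.2.1]
    simp

theorem complexIncl_one : complexIncl 1 = 0 := by
  have h := eq_antiHermitianPart_add 1
  have h1 : antiHermitianPart 1 = 0 := antiHermitianPart_eq_zero (by simp)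
  have h2 : antiHermitianPart (-Complex.I • 1) = 0 := by
    apply Subtype.ext
    simp [antiHermitianPart]
    match_scalars
    rw [map_ofNat]
    ring
  change incl _ + Complex.I • incl _ = _
  rw [h1, h2]
  change inclₗ 0 + Complex.I • inclₗ 0 = _
  simp

/-- Both sides are complex bilinear and ignore scalar matrices, so the bracket relation on su(3)
suffices. -/
theorem complexIncl_lie (M N : Matrix (Fin 3) (Fin 3) ℂ) :
    complexIncl (M * N - N * M) =
      complexIncl M * complexIncl N - complexIncl N * complexIncl M := by
  have key (X Y : su3) : complexIncl ((X : Matrix (Fin 3) (Fin 3) ℂ) * Y - Y * X) =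
      complexIncl X * complexIncl Y - complexIncl Y * complexIncl X := by
    rw [complexIncl_coe, complexIncl_coe, ← incl_lie, ← complexIncl_coe]
    rfl
  rw [eq_antiHermitianPart_add M, eq_antiHermitianPart_add N]
  generalize antiHermitianPart M = X
  generalize antiHermitianPart (-Complex.I • M) = Y
  generalize antiHermitianPart N = X'
  generalize antiHermitianPart (-Complex.I • N) = Y'
  generalize M.trace / 3 = c
  generalize N.trace / 3 = d
  have e : ((X : Matrix (Fin 3) (Fin 3) ℂ) + Complex.I • (Y : Matrix (Fin 3) (Fin 3) ℂ) + c • 1) *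
        (X' + Complex.I • (Y' : Matrix (Fin 3) (Fin 3) ℂ) + d • 1) -
      (X' + Complex.I • (Y' : Matrix (Fin 3) (Fin 3) ℂ) + d • 1) *
        (X + Complex.I • (Y : Matrix (Fin 3) (Fin 3) ℂ) + c • 1) =
      ((X : Matrix (Fin 3) (Fin 3) ℂ) * X' - X' * X) +
      Complex.I • ((X : Matrix (Fin 3) (Fin 3) ℂ) * Y' - Y' * X) +
      Complex.I • ((Y : Matrix (Fin 3) (Fin 3) ℂ) * X' - X' * Y) +
      (Complex.I * Complex.I) • ((Y : Matrix (Fin 3) (Fin 3) ℂ) * Y' - Y' * Y) := by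
    simp only [add_mul, mul_add, smul_mul_assoc, mul_smul_comm, mul_one, one_mul]
    module
  rw [e]
  simp only [map_add, map_smul, key, complexIncl_one, smul_zero, add_zero]
  simp only [add_mul, mul_add, smul_mul_assoc, mul_smul_comm]
  module

theorem L_eq_complexIncl (a : ℕ) : L a = complexIncl (gellMann a) := by
  rw [L, ← complexIncl_coe, iGellMann, map_smul, smul_smul]
  simp

/-! ### The formal adjoint -/

theorem antipode_mul (u v : UniversalEnvelopingAlgebra ℝ su3) :
    antipode (u * v) = antipode v * antipode u := by
  simp [antipode]

theorem adjoint_tmul (c : ℂ) (u : UniversalEnvelopingAlgebra ℝ su3) :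
    adjoint (c ⊗ₜ[ℝ] u) = (starRingEnd ℂ c) ⊗ₜ[ℝ] antipode u := rfl

theorem adjoint_mul (z w : Env) : adjoint (z * w) = adjoint w * adjoint z := by
  induction z using TensorProduct.induction_on with
  | zero => simp
  | add x y hx hy => rw [add_mul, map_add, hx, hy, map_add, mul_add]
  | tmul c u =>
    induction w using TensorProduct.induction_on with
    | zero => simp
    | add x y hx hy => rw [mul_add, map_add, hx, hy, map_add, add_mul]
    | tmul d v =>
      simp only [Algebra.TensorProduct.tmul_mul_tmul, adjoint_tmul, antipode_mul, map_mul]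
      rw [mul_comm]

theorem adjoint_smul (c : ℂ) (z : Env) : adjoint (c • z) = (starRingEnd ℂ c) • adjoint z := by
  induction z using TensorProduct.induction_on with
  | zero => simp
  | add x y hx hy => rw [smul_add, map_add, hx, hy, map_add, smul_add]
  | tmul d v => simp [adjoint_tmul, TensorProduct.smul_tmul']

theorem adjoint_incl (X : su3) : adjoint (incl X) = -incl X := by
  rw [incl, adjoint_tmul, ← TensorProduct.tmul_neg]
  simp [antipode, negOp]

theorem adjoint_complexIncl (M : Matrix (Fin 3) (Fin 3) ℂ) :
    adjoint (complexIncl M) = complexIncl M.conjTranspose := by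
  have h : -Complex.I • M.conjTranspose = (-(-Complex.I • M)).conjTranspose := by
    simp [Matrix.conjTranspose_smul]
  change adjoint (incl _ + Complex.I • incl _) = inclₗ _ + Complex.I • inclₗ _
  rw [map_add, adjoint_smul, adjoint_incl, adjoint_incl, h, antiHermitianPart_conjTranspose,
    antiHermitianPart_conjTranspose]
  change -inclₗ _ + (starRingEnd ℂ) Complex.I • -inclₗ _ = _
  simp only [map_neg, neg_neg, Complex.conj_I, smul_neg, neg_smul]

/-! ### Matrix units and Gell-Mann generators -/

/-- The image of the matrix unit `E_{ij}`. -/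
def unit (i j : Fin 3) : Env := complexIncl (Matrix.single i j 1)

theorem unit_mul_sub (i j k l : Fin 3) :
    unit i j * unit k l - unit k l * unit i j =
      (if j = k then unit i l else 0) - (if l = i then unit k j else 0) := by
  rw [unit, unit, ← complexIncl_lie, map_sub]
  congr 1
  · split_ifs with h
    · subst h
      simp [unit]
    · rw [Matrix.single_mul_single_of_ne _ _ _ _ h, map_zero]
  · split_ifs with h
    · subst h
      simp [unit]
    · rw [Matrix.single_mul_single_of_ne _ _ _ _ h, map_zero]

theorem unit_trace : unit 0 0 + unit 1 1 + unit 2 2 = 0 := by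
  rw [unit, unit, unit, ← map_add, ← map_add, ← complexIncl_one]
  congr 1
  ext i j
  fin_cases i <;> fin_cases j <;> simp [Matrix.single]

theorem adjoint_unit (i j : Fin 3) : adjoint (unit i j) = unit j i := by
  rw [unit, adjoint_complexIncl, Matrix.conjTranspose_single, star_one, unit]

theorem complexIncl_eq_sum (M : Matrix (Fin 3) (Fin 3) ℂ) :
    complexIncl M = ∑ i, ∑ j, M i j • unit i j := by
  conv_lhs => rw [Matrix.matrix_eq_sum_single M]
  simp only [map_sum]
  refine Finset.sum_congr rfl fun i _ => Finset.sum_congr rfl fun j _ => ?_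
  rw [unit, ← map_smul, Matrix.smul_single, smul_eq_mul, mul_one]

theorem generators_eq_range : generators = LinearMap.range complexIncl := by
  apply le_antisymm
  · refine Submodule.span_le.2 ?_
    rintro _ ⟨X, rfl⟩
    exact ⟨X, complexIncl_coe X⟩
  · rintro _ ⟨M, rfl⟩
    exact add_mem (Submodule.subset_span ⟨_, rfl⟩)
      (Submodule.smul_mem _ _ (Submodule.subset_span ⟨_, rfl⟩))

theorem unit_mem_generators (i j : Fin 3) : unit i j ∈ generators := by
  rw [generators_eq_range]
  exact ⟨_, rfl⟩

theorem L_one : L 1 = unit 0 1 + unit 1 0 := by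
  rw [L_eq_complexIncl, complexIncl_eq_sum]
  simp [Fin.sum_univ_three, gellMann]

theorem L_two : L 2 = -Complex.I • (unit 0 1 - unit 1 0) := by
  rw [L_eq_complexIncl, complexIncl_eq_sum]
  simp [Fin.sum_univ_three, gellMann]
  module

theorem L_three : L 3 = unit 0 0 - unit 1 1 := by
  rw [L_eq_complexIncl, complexIncl_eq_sum]
  simp [Fin.sum_univ_three, gellMann]
  module

theorem L_four : L 4 = unit 0 2 + unit 2 0 := by
  rw [L_eq_complexIncl, complexIncl_eq_sum]
  simp [Fin.sum_univ_three, gellMann]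

theorem L_five : L 5 = -Complex.I • (unit 0 2 - unit 2 0) := by
  rw [L_eq_complexIncl, complexIncl_eq_sum]
  simp [Fin.sum_univ_three, gellMann]
  module

theorem L_six : L 6 = unit 1 2 + unit 2 1 := by
  rw [L_eq_complexIncl, complexIncl_eq_sum]
  simp [Fin.sum_univ_three, gellMann]

theorem L_seven : L 7 = -Complex.I • (unit 1 2 - unit 2 1) := by
  rw [L_eq_complexIncl, complexIncl_eq_sum]
  simp [Fin.sum_univ_three, gellMann]
  module

theorem sqrt_three_mul_self : ((√3 : ℝ) : ℂ) * ((√3 : ℝ) : ℂ) = 3 := by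
  rw [← Complex.ofReal_mul, Real.mul_self_sqrt (by norm_num)]
  norm_num

theorem L_eight : L 8 = -((√3 : ℝ) : ℂ) • unit 2 2 := by
  have h0 : ((√3 : ℝ) : ℂ) ≠ 0 := by
    intro h
    have := sqrt_three_mul_self
    rw [h] at this
    norm_num at this
  -- By the trace relation e₀₀ + e₁₁ - 2e₂₂ = -3e₂₂, which after division by √3 gives -√3 e₂₂.
  have h : unit 0 0 = -unit 1 1 - unit 2 2 := by
    rw [← sub_eq_zero, ← unit_trace]
    abel
  rw [L_eq_complexIncl, complexIncl_eq_sum]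
  simp [Fin.sum_univ_three, gellMann, h]
  match_scalars
  · ring
  · field_simp
    linear_combination sqrt_three_mul_self

/-! ### Extracting the kernel of an operator from a spanning set of eigenvectors -/

/-- The span of the eigenvectors of `f` with nonzero eigenvalue. -/
def nonzeroPart {V : Type*} [AddCommGroup V] [Module ℂ V] (f : Module.End ℂ V) : Submodule ℂ V :=
  ⨆ μ : ℂ, ⨆ _ : μ ≠ 0, f.eigenspace μ

theorem mem_nonzeroPart {V : Type*} [AddCommGroup V] [Module ℂ V] {f : Module.End ℂ V} {v : V}
    (μ : ℂ) (hμ : μ ≠ 0) (h : f v = μ • v) : v ∈ nonzeroPart f :=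
  Submodule.mem_iSup_of_mem μ (Submodule.mem_iSup_of_mem hμ (Module.End.mem_eigenspace_iff.2 h))

/-- If f kills z and N, then the component of z in `nonzeroPart f` lies in the 0-eigenspace too, and
independence of the eigenspaces makes it zero. Applied twice, for torus weights and for isospin. -/
theorem mem_of_mem_sup_nonzeroPart {V : Type*} [AddCommGroup V] [Module ℂ V]
    {f : Module.End ℂ V} {N : Submodule ℂ V} (hN : ∀ v ∈ N, f v = 0) {z : V}
    (hz : z ∈ N ⊔ nonzeroPart f) (hfz : f z = 0) : z ∈ N := by
  obtain ⟨y, hy, n, hn, rfl⟩ := Submodule.mem_sup.1 hz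
  have h0 : n ∈ f.eigenspace 0 := by
    rw [Module.End.mem_eigenspace_iff, zero_smul]
    rwa [map_add, hN y hy, zero_add] at hfz
  have : n = 0 := Submodule.disjoint_def.1 (f.eigenspaces_iSupIndep 0) n h0 hn
  rwa [this, add_zero]

/-! ### Abstract matrix units and the U(2)-invariants -/

section MatrixUnits

variable {R : Type*} [Ring R] [Algebra ℂ R]

/-- The commutator with `x` as a linear map. -/
def commutator (x : R) : R →ₗ[ℂ] R := LinearMap.mulLeft ℂ x - LinearMap.mulRight ℂ x

theorem commutator_apply (x y : R) : commutator x y = x * y - y * x := rfl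

theorem commutator_mul (x y z : R) :
    commutator x (y * z) = commutator x y * z + y * commutator x z := by
  simp only [commutator_apply]
  noncomm_ring

theorem commutator_eq_zero_iff {x y : R} : commutator x y = 0 ↔ x * y = y * x := sub_eq_zero

/-- The relations of the generators `e i j` of `gl(3)` modulo the identity matrix. -/
structure IsMatrixUnits (e : Fin 3 → Fin 3 → R) : Prop where
  comm : ∀ i j k l, e i j * e k l - e k l * e i j =
    (if j = k then e i l else 0) - (if l = i then e k j else 0)
  trace : e 0 0 + e 1 1 + e 2 2 = 0

/-- A numbering of the matrix units in which the lowering operators come first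
and the raising operators last. -/
def unitRank (i j : Fin 3) : ℕ := 3 * (j.val + 3 - i.val) + i.val

namespace IsMatrixUnits

variable {e : Fin 3 → Fin 3 → R}

theorem commutator_unit (h : IsMatrixUnits e) (i j k l : Fin 3) :
    commutator (e i j) (e k l) = (if j = k then e i l else 0) - (if l = i then e k j else 0) :=
  h.comm i j k l

-- The rank condition orients the commutation relation, so that as a rewrite rule it only moves a
-- lower-ranked factor to the left. Rewriting then brings products into a normal order with raising
-- operators on the right.
omit [Algebra ℂ R] in
theorem mul_swap (h : IsMatrixUnits e) {i j k l : Fin 3} (_ : unitRank k l < unitRank i j) :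
    e i j * e k l = e k l * e i j + ((if j = k then e i l else 0) - (if l = i then e k j else 0)) := by
  rw [← h.comm]
  abel

omit [Algebra ℂ R] in
theorem mul_swap_assoc (h : IsMatrixUnits e) {i j k l : Fin 3} (hr : unitRank k l < unitRank i j)
    (x : R) : e i j * (e k l * x) = e k l * (e i j * x) +
      ((if j = k then e i l else 0) - (if l = i then e k j else 0)) * x := by
  rw [← mul_assoc, h.mul_swap hr, add_mul, mul_assoc]

omit [Algebra ℂ R] in
theorem unit_zero_zero (h : IsMatrixUnits e) : e 0 0 = -e 1 1 - e 2 2 := by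
  rw [← sub_eq_zero, ← h.trace]
  abel

end IsMatrixUnits

/-- The quadratic Casimir element of `SU(2)`. -/
def isospinCasimir (e : Fin 3 → Fin 3 → R) : R :=
  (e 0 0 - e 1 1) * (e 0 0 - e 1 1) + (2 : ℂ) • (e 0 0 - e 1 1) + (4 : ℂ) • (e 1 0 * e 0 1)

/-- The quadratic `U(2)`-invariant built from the two doublets. -/
def doubletQuadratic (e : Fin 3 → Fin 3 → R) : R := e 0 2 * e 2 0 + e 1 2 * e 2 1

/-- The diagonal component of the triplet built from the two doublets. -/
def doubletTriplet (e : Fin 3 → Fin 3 → R) : R := e 0 2 * e 2 0 - e 1 2 * e 2 1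

/-- The off-diagonal part of the contraction of the doublet triplet with `su(2)`. -/
def doubletExchange (e : Fin 3 → Fin 3 → R) : R :=
  e 0 2 * e 2 1 * e 1 0 + e 1 2 * e 2 0 * e 0 1

/-- The cubic `U(2)`-invariant built from the two doublets and `su(2)`. -/
def doubletCubic (e : Fin 3 → Fin 3 → R) : R :=
  (1 / 2 : ℂ) • (doubletTriplet e * (e 0 0 - e 1 1)) + doubletExchange e

/-- A spanning set of the `U(2)`-invariant cubic elements. -/
def invariants (e : Fin 3 → Fin 3 → R) : Fin 8 → R :=
  ![e 2 2, e 2 2 * e 2 2, e 2 2 * e 2 2 * e 2 2, isospinCasimir e, isospinCasimir e * e 2 2,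
    doubletQuadratic e, doubletQuadratic e * e 2 2, doubletCubic e]

/-- The quadratic Casimir element, in terms of matrix units. -/
def quadraticCasimir (e : Fin 3 → Fin 3 → R) : R :=
  (1 / 12 : ℂ) • isospinCasimir e + (1 / 3 : ℂ) • doubletQuadratic e + (1 / 2 : ℂ) • e 2 2 +
    (1 / 4 : ℂ) • (e 2 2 * e 2 2)

/-- The cubic Casimir element, in terms of matrix units. -/
def cubicCasimir (e : Fin 3 → Fin 3 → R) : R :=
  doubletCubic e - (1 / 4 : ℂ) • isospinCasimir e - (1 / 4 : ℂ) • (isospinCasimir e * e 2 2) +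
    (1 / 2 : ℂ) • (doubletQuadratic e * e 2 2) + (3 / 4 : ℂ) • (e 2 2 * e 2 2) +
    (1 / 4 : ℂ) • (e 2 2 * e 2 2 * e 2 2) + (1 / 2 : ℂ) • e 2 2

/-- A basis, ordered so that the ordered zero weight monomials are convenient. -/
def orderedBasis (e : Fin 3 → Fin 3 → R) : Fin 8 → R :=
  ![e 0 2, e 1 2, e 2 0, e 2 1, e 1 0, e 0 1, e 0 0 - e 1 1, e 2 2]

/-- The weights of the ordered basis with respect to `e 1 1 + 4 e 2 2`. -/
def basisWeight : Fin 8 → ℤ := ![-4, -3, 4, 3, 1, -1, 0, 0]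

/-- The span of the matrix units. -/
def linearSpan (e : Fin 3 → Fin 3 → R) : Submodule ℂ R :=
  Submodule.span ℂ (Set.range (orderedBasis e))

/-- The span of the ordered monomials of degree one and two. -/
def orderedQuadratic (e : Fin 3 → Fin 3 → R) : Submodule ℂ R :=
  linearSpan e ⊔ Submodule.span ℂ {y | ∃ i j, i ≤ j ∧ y = orderedBasis e i * orderedBasis e j}

/-- The span of the ordered monomials of degree one, two and three. -/
def orderedCubic (e : Fin 3 → Fin 3 → R) : Submodule ℂ R :=
  orderedQuadratic e ⊔ Submodule.span ℂ
    {y | ∃ i j k, i ≤ j ∧ j ≤ k ∧ y = orderedBasis e i * orderedBasis e j * orderedBasis e k}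

/-- The ordered monomials of degree one, two and three and of weight zero. -/
def zeroWeightMonomials (e : Fin 3 → Fin 3 → R) : Set R :=
  {y | (∃ i, basisWeight i = 0 ∧ y = orderedBasis e i) ∨
    (∃ i j, i ≤ j ∧ basisWeight i + basisWeight j = 0 ∧ y = orderedBasis e i * orderedBasis e j) ∨
    ∃ i j k, i ≤ j ∧ j ≤ k ∧ basisWeight i + basisWeight j + basisWeight k = 0 ∧
      y = orderedBasis e i * orderedBasis e j * orderedBasis e k}

/-- The operator `ad(e₁₀) ad(e₀₁)`, which is the quadratic Casimir element of `SU(2)`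
on the weight zero space. -/
def isospinLaplacian (e : Fin 3 → Fin 3 → R) : Module.End ℂ R :=
  commutator (e 1 0) ∘ₗ commutator (e 0 1)

theorem isospinLaplacian_apply (e : Fin 3 → Fin 3 → R) (y : R) :
    isospinLaplacian e y = commutator (e 1 0) (commutator (e 0 1) y) := rfl

/-! ### Invariance and centrality -/

namespace IsMatrixUnits

variable {e : Fin 3 → Fin 3 → R}

/-- The condition on `(i, j)` selects the block-diagonal units, those of gl(2) ⊕ gl(1). -/
theorem commutator_isospinCasimir (h : IsMatrixUnits e) {i j : Fin 3}
    (hij : i = 2 ∧ j = 2 ∨ i ≠ 2 ∧ j ≠ 2) : commutator (e i j) (isospinCasimir e) = 0 := by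
  fin_cases i <;> fin_cases j <;> simp at hij <;>
  simp [isospinCasimir, commutator_mul, h.commutator_unit] <;>
  simp (decide := true) only [mul_sub, sub_mul, mul_add, add_mul, neg_mul, mul_neg, h.mul_swap,
    reduceIte, sub_zero, zero_sub] <;>
  module

theorem commutator_doubletQuadratic (h : IsMatrixUnits e) {i j : Fin 3}
    (hij : i = 2 ∧ j = 2 ∨ i ≠ 2 ∧ j ≠ 2) : commutator (e i j) (doubletQuadratic e) = 0 := by
  fin_cases i <;> fin_cases j <;> simp at hij <;>
  simp [doubletQuadratic, commutator_mul, h.commutator_unit]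

theorem commutator_doubletCubic (h : IsMatrixUnits e) {i j : Fin 3}
    (hij : i = 2 ∧ j = 2 ∨ i ≠ 2 ∧ j ≠ 2) : commutator (e i j) (doubletCubic e) = 0 := by
  fin_cases i <;> fin_cases j <;> simp at hij <;>
  simp [doubletCubic, doubletTriplet, doubletExchange, commutator_mul, h.commutator_unit] <;>
  simp (decide := true) only [mul_sub, sub_mul, mul_add, add_mul, neg_mul, mul_neg, mul_assoc,
    h.mul_swap, h.mul_swap_assoc, reduceIte, sub_zero, add_zero, zero_sub] <;>
  module

theorem commutator_invariants (h : IsMatrixUnits e) {i j : Fin 3}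
    (hij : i = 2 ∧ j = 2 ∨ i ≠ 2 ∧ j ≠ 2) (n : Fin 8) :
    commutator (e i j) (invariants e n) = 0 := by
  have hZ : commutator (e i j) (e 2 2) = 0 := by
    rw [h.commutator_unit]
    rcases hij with ⟨rfl, rfl⟩ | ⟨hi, hj⟩
    · simp
    · rw [if_neg hj, if_neg hi.symm, sub_zero]
  fin_cases n <;>
  simp [invariants, commutator_mul, hZ, h.commutator_isospinCasimir hij,
    h.commutator_doubletQuadratic hij, h.commutator_doubletCubic hij]

/-- `quadraticCasimir` is the normal form of Ω₂ at α = β = γ = 1; after normal ordering and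
elimination of e₀₀ all terms cancel. -/
theorem commutator_quadraticCasimir (h : IsMatrixUnits e) (i j : Fin 3) :
    commutator (e i j) (quadraticCasimir e) = 0 := by
  fin_cases i <;> fin_cases j <;>
  simp [quadraticCasimir, isospinCasimir, doubletQuadratic, commutator_mul,
    h.commutator_unit] <;>
  simp (decide := true) only [mul_sub, sub_mul, mul_add, add_mul, neg_mul, mul_neg,
    h.mul_swap, reduceIte, sub_zero, add_zero, zero_sub, h.unit_zero_zero] <;>
  module

/-- `cubicCasimir` is the normal form of Ω₃ with all parameters equal to 1. Block-diagonal units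
commute with each summand, so only the four doublet units require a computation. -/
theorem commutator_cubicCasimir (h : IsMatrixUnits e) (i j : Fin 3) :
    commutator (e i j) (cubicCasimir e) = 0 := by
  by_cases hij : i = 2 ∧ j = 2 ∨ i ≠ 2 ∧ j ≠ 2
  · have hv := h.commutator_invariants hij
    simp only [cubicCasimir, map_add, map_sub, map_smul]
    rw [show commutator (e i j) (doubletCubic e) = 0 from hv 7,
      show commutator (e i j) (isospinCasimir e) = 0 from hv 3,
      show commutator (e i j) (isospinCasimir e * e 2 2) = 0 from hv 4,
      show commutator (e i j) (doubletQuadratic e * e 2 2) = 0 from hv 6,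
      show commutator (e i j) (e 2 2) = 0 from hv 0,
      show commutator (e i j) (e 2 2 * e 2 2) = 0 from hv 1,
      show commutator (e i j) (e 2 2 * e 2 2 * e 2 2) = 0 from hv 2]
    simp
  · fin_cases i <;> fin_cases j <;> simp at hij <;>
    simp [cubicCasimir, isospinCasimir, doubletQuadratic, doubletCubic, doubletTriplet,
      doubletExchange, commutator_mul, h.commutator_unit] <;>
    simp (decide := true) only [mul_sub, sub_mul, mul_add, add_mul, neg_mul, mul_neg, mul_assoc,
      h.mul_swap, h.mul_swap_assoc, reduceIte, sub_zero, add_zero, zero_sub, zero_mul,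
      smul_mul_assoc, h.unit_zero_zero] <;>
    module

/-! ### Ordered monomials and torus weights -/

theorem unit_mem_linearSpan (h : IsMatrixUnits e) (i j : Fin 3) : e i j ∈ linearSpan e := by
  have hx (n : Fin 8) : orderedBasis e n ∈ linearSpan e := Submodule.subset_span ⟨n, rfl⟩
  have h00 : e 0 0 = (1 / 2 : ℂ) • (orderedBasis e 6 - orderedBasis e 7) := by
    simp only [orderedBasis, Matrix.cons_val, h.unit_zero_zero]
    module
  have h11 : e 1 1 = (-1 / 2 : ℂ) • (orderedBasis e 6 + orderedBasis e 7) := by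
    simp only [orderedBasis, Matrix.cons_val, h.unit_zero_zero]
    module
  fin_cases i <;> fin_cases j
  · exact h00 ▸ Submodule.smul_mem _ _ (sub_mem (hx 6) (hx 7))
  · exact hx 5
  · exact hx 0
  · exact hx 4
  · exact h11 ▸ Submodule.smul_mem _ _ (add_mem (hx 6) (hx 7))
  · exact hx 1
  · exact hx 2
  · exact hx 3
  · exact hx 7

theorem linearSpan_eq (h : IsMatrixUnits e) :
    linearSpan e = Submodule.span ℂ (Set.range fun p : Fin 3 × Fin 3 => e p.1 p.2) := by
  apply le_antisymm
  · have hx (i j : Fin 3) :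
        e i j ∈ Submodule.span ℂ (Set.range fun p : Fin 3 × Fin 3 => e p.1 p.2) :=
      Submodule.subset_span ⟨(i, j), rfl⟩
    refine Submodule.span_le.2 ?_
    rintro _ ⟨n, rfl⟩
    fin_cases n
    exacts [hx _ _, hx _ _, hx _ _, hx _ _, hx _ _, hx _ _, sub_mem (hx _ _) (hx _ _), hx _ _]
  · refine Submodule.span_le.2 ?_
    rintro _ ⟨p, rfl⟩
    exact h.unit_mem_linearSpan _ _

theorem commutator_mem_linearSpan (h : IsMatrixUnits e) {x y : R} (hx : x ∈ linearSpan e)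
    (hy : y ∈ linearSpan e) : x * y - y * x ∈ linearSpan e := by
  rw [h.linearSpan_eq] at hx hy
  induction hx using Submodule.span_induction with
  | zero => simp
  | add a b _ _ ha hb =>
    rw [add_mul, mul_add, add_sub_add_comm]
    exact add_mem ha hb
  | smul c a _ ha =>
    rw [smul_mul_assoc, mul_smul_comm, ← smul_sub]
    exact Submodule.smul_mem _ _ ha
  | mem a ha =>
    obtain ⟨p, rfl⟩ := ha
    induction hy using Submodule.span_induction with
    | zero => simp
    | add a b _ _ ha hb =>
      rw [add_mul, mul_add, add_sub_add_comm]
      exact add_mem ha hb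
    | smul c a _ ha =>
      rw [smul_mul_assoc, mul_smul_comm, ← smul_sub]
      exact Submodule.smul_mem _ _ ha
    | mem b hb =>
      obtain ⟨q, rfl⟩ := hb
      rw [h.comm]
      refine sub_mem ?_ ?_ <;> split_ifs <;>
        first | exact zero_mem _ | exact h.unit_mem_linearSpan _ _

theorem sq_linearSpan_le (h : IsMatrixUnits e) : linearSpan e ^ 2 ≤ orderedQuadratic e := by
  rw [sq]
  conv_lhs => rw [linearSpan, Submodule.span_mul_span]
  refine Submodule.span_le.2 ?_
  rintro _ ⟨_, ⟨i, rfl⟩, _, ⟨j, rfl⟩, rfl⟩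
  have hx (n : Fin 8) : orderedBasis e n ∈ linearSpan e := Submodule.subset_span ⟨n, rfl⟩
  rcases le_total i j with hij | hij
  · exact Submodule.mem_sup_right (Submodule.subset_span ⟨i, j, hij, rfl⟩)
  · have := add_mem
      (Submodule.mem_sup_left (h.commutator_mem_linearSpan (hx i) (hx j)) : _ ∈ orderedQuadratic e)
      (Submodule.mem_sup_right (Submodule.subset_span ⟨j, i, hij, rfl⟩) : _ ∈ orderedQuadratic e)
    rwa [sub_add_cancel] at this

/-- Sorting three factors by adjacent transpositions: each swap costs a commutator, which is linear,
times the remaining factor, and this is already covered in degree two. -/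
theorem cube_linearSpan_le (h : IsMatrixUnits e) : linearSpan e ^ 3 ≤ orderedCubic e := by
  have hx (n : Fin 8) : orderedBasis e n ∈ linearSpan e := Submodule.subset_span ⟨n, rfl⟩
  have hq {x y : R} (hx : x ∈ linearSpan e) (hy : y ∈ linearSpan e) : x * y ∈ orderedCubic e :=
    Submodule.mem_sup_left (h.sq_linearSpan_le (sq (linearSpan e) ▸ Submodule.mul_mem_mul hx hy))
  rw [pow_three']
  conv_lhs => rw [linearSpan, Submodule.span_mul_span, Submodule.span_mul_span]
  refine Submodule.span_le.2 ?_
  rintro _ ⟨_, ⟨_, ⟨i, rfl⟩, _, ⟨j, rfl⟩, rfl⟩, _, ⟨k, rfl⟩, rfl⟩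
  have base {i j k : Fin 8} (hij : i ≤ j) (hjk : j ≤ k) :
      orderedBasis e i * orderedBasis e j * orderedBasis e k ∈ orderedCubic e :=
    Submodule.mem_sup_right (Submodule.subset_span ⟨i, j, k, hij, hjk, rfl⟩)
  have swapL {i j k : Fin 8}
      (hm : orderedBasis e j * orderedBasis e i * orderedBasis e k ∈ orderedCubic e) :
      orderedBasis e i * orderedBasis e j * orderedBasis e k ∈ orderedCubic e := by
    have := add_mem hm (hq (h.commutator_mem_linearSpan (hx i) (hx j)) (hx k))
    rwa [sub_mul, add_sub_cancel] at this
  have swapR {i j k : Fin 8}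
      (hm : orderedBasis e i * orderedBasis e k * orderedBasis e j ∈ orderedCubic e) :
      orderedBasis e i * orderedBasis e j * orderedBasis e k ∈ orderedCubic e := by
    have := add_mem hm (hq (hx i) (h.commutator_mem_linearSpan (hx j) (hx k)))
    rwa [mul_sub, ← mul_assoc, ← mul_assoc, add_sub_cancel] at this
  change orderedBasis e i * orderedBasis e j * orderedBasis e k ∈ orderedCubic e
  rcases le_total i j with hij | hij <;> rcases le_total j k with hjk | hjk <;>
    rcases le_total i k with hik | hik
  · exact base hij hjk
  · exact base hij hjk
  · exact swapR (base hik hjk)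
  · exact swapR (swapL (base hik hij))
  · exact swapL (base hij hik)
  · exact swapL (swapR (base hjk hik))
  · exact swapL (swapR (swapL (base hjk hij)))
  · exact swapL (swapR (swapL (base hjk hij)))

/-- The diagonal element has entries (0, 1, 4). The gap is wide enough that products of at most
three basis elements have weight 0 only if they are invariant under the whole torus; with 3 in place
of 4, e₁₂e₁₀e₁₀ would also have weight 0. -/
theorem commutator_orderedBasis (h : IsMatrixUnits e) (n : Fin 8) :
    commutator (e 1 1 + (4 : ℂ) • e 2 2) (orderedBasis e n) =
      (basisWeight n : ℂ) • orderedBasis e n := by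
  have hc (y : R) : commutator (e 1 1 + (4 : ℂ) • e 2 2) y =
      commutator (e 1 1) y + (4 : ℂ) • commutator (e 2 2) y := by
    simp only [commutator_apply, add_mul, mul_add, smul_mul_assoc, mul_smul_comm]
    module
  fin_cases n <;> simp [hc, orderedBasis, basisWeight, h.commutator_unit] <;> module

theorem orderedCubic_le (h : IsMatrixUnits e) :
    orderedCubic e ≤ Submodule.span ℂ (zeroWeightMonomials e) ⊔
      nonzeroPart (commutator (e 1 1 + (4 : ℂ) • e 2 2)) := by
  have h2 (i j : Fin 8) : commutator (e 1 1 + (4 : ℂ) • e 2 2)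
      (orderedBasis e i * orderedBasis e j) =
      ((basisWeight i + basisWeight j : ℤ) : ℂ) • (orderedBasis e i * orderedBasis e j) := by
    rw [commutator_mul, h.commutator_orderedBasis, h.commutator_orderedBasis, smul_mul_assoc,
      mul_smul_comm, ← add_smul, Int.cast_add]
  refine sup_le (sup_le ?_ ?_) ?_ <;> refine Submodule.span_le.2 ?_
  · rintro _ ⟨i, rfl⟩
    by_cases hw : basisWeight i = 0
    · exact Submodule.mem_sup_left (Submodule.subset_span (Or.inl ⟨i, hw, rfl⟩))
    · exact Submodule.mem_sup_right
        (mem_nonzeroPart _ (Int.cast_ne_zero.2 hw) (h.commutator_orderedBasis i))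
  · rintro _ ⟨i, j, hij, rfl⟩
    by_cases hw : basisWeight i + basisWeight j = 0
    · exact Submodule.mem_sup_left
        (Submodule.subset_span (Or.inr (Or.inl ⟨i, j, hij, hw, rfl⟩)))
    · exact Submodule.mem_sup_right (mem_nonzeroPart _ (Int.cast_ne_zero.2 hw) (h2 i j))
  · rintro _ ⟨i, j, k, hij, hjk, rfl⟩
    by_cases hw : basisWeight i + basisWeight j + basisWeight k = 0
    · exact Submodule.mem_sup_left
        (Submodule.subset_span (Or.inr (Or.inr ⟨i, j, k, hij, hjk, hw, rfl⟩)))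
    · refine Submodule.mem_sup_right (mem_nonzeroPart _ (Int.cast_ne_zero.2 hw) ?_)
      rw [commutator_mul, h2, h.commutator_orderedBasis, smul_mul_assoc, mul_smul_comm, ← add_smul,
        ← Int.cast_add]

theorem commutator_zeroWeightMonomials (h : IsMatrixUnits e) {y : R}
    (hy : y ∈ Submodule.span ℂ (zeroWeightMonomials e)) :
    commutator (e 1 1 + (4 : ℂ) • e 2 2) y = 0 := by
  induction hy using Submodule.span_induction with
  | zero => simp
  | add a b _ _ ha hb => rw [map_add, ha, hb, add_zero]
  | smul c a _ ha => rw [map_smul, ha, smul_zero]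
  | mem a ha =>
    rcases ha with ⟨i, hw, rfl⟩ | ⟨i, j, -, hw, rfl⟩ | ⟨i, j, k, -, -, hw, rfl⟩
    · rw [h.commutator_orderedBasis, hw, Int.cast_zero, zero_smul]
    · rw [commutator_mul, h.commutator_orderedBasis, h.commutator_orderedBasis, smul_mul_assoc,
        mul_smul_comm, ← add_smul, ← Int.cast_add, hw, Int.cast_zero, zero_smul]
    · rw [commutator_mul, commutator_mul, h.commutator_orderedBasis, h.commutator_orderedBasis,
        h.commutator_orderedBasis, smul_mul_assoc, mul_smul_comm, ← add_smul, ← Int.cast_add,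
        smul_mul_assoc, mul_smul_comm, ← add_smul, ← Int.cast_add, hw, Int.cast_zero, zero_smul]

/-! ### Isospin decomposition of the zero weight space -/

theorem isospinLaplacian_mul_hypercharge (h : IsMatrixUnits e) {μ : ℂ} {y : R}
    (hy : isospinLaplacian e y = μ • y) :
    isospinLaplacian e (y * e 2 2) = μ • (y * e 2 2) := by
  rw [isospinLaplacian_apply] at hy ⊢
  simp [commutator_mul, h.commutator_unit, hy]

/-- The Cartan element is the middle vector of the adjoint triplet, so j = 1 and j(j+1) = 2. -/
theorem isospinLaplacian_cartan (h : IsMatrixUnits e) :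
    isospinLaplacian e (e 0 0 - e 1 1) = (2 : ℂ) • (e 0 0 - e 1 1) := by
  simp [isospinLaplacian_apply, h.commutator_unit]
  module

theorem isospinLaplacian_isospinCasimir_mul (h : IsMatrixUnits e) :
    isospinLaplacian e (isospinCasimir e * (e 0 0 - e 1 1)) =
      (2 : ℂ) • (isospinCasimir e * (e 0 0 - e 1 1)) := by
  have h1 := h.isospinLaplacian_cartan
  rw [isospinLaplacian_apply] at h1 ⊢
  rw [commutator_mul, h.commutator_isospinCasimir (by decide), zero_mul, zero_add, commutator_mul,
    h.commutator_isospinCasimir (by decide), h1, zero_mul, zero_add, mul_smul_comm]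

theorem isospinLaplacian_doubletQuadratic_mul (h : IsMatrixUnits e) :
    isospinLaplacian e (doubletQuadratic e * (e 0 0 - e 1 1)) =
      (2 : ℂ) • (doubletQuadratic e * (e 0 0 - e 1 1)) := by
  have h1 := h.isospinLaplacian_cartan
  rw [isospinLaplacian_apply] at h1 ⊢
  rw [commutator_mul, h.commutator_doubletQuadratic (by decide), zero_mul, zero_add,
    commutator_mul, h.commutator_doubletQuadratic (by decide), h1, zero_mul, zero_add,
    mul_smul_comm]

theorem isospinLaplacian_doubletTriplet (h : IsMatrixUnits e) :
    isospinLaplacian e (doubletTriplet e) = (2 : ℂ) • doubletTriplet e := by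
  simp [isospinLaplacian_apply, doubletTriplet, commutator_mul, h.commutator_unit]
  module

/-- This is the "cross product" of the doublet triplet with su(2), the j = 1 part of 3 ⊗ 3. -/
theorem isospinLaplacian_antisymmetric (h : IsMatrixUnits e) :
    isospinLaplacian e (e 0 2 * e 2 1 * e 1 0 - e 1 2 * e 2 0 * e 0 1) =
      (2 : ℂ) • (e 0 2 * e 2 1 * e 1 0 - e 1 2 * e 2 0 * e 0 1) := by
  simp [isospinLaplacian_apply, commutator_mul, h.commutator_unit]
  simp only [mul_sub, mul_add, add_mul, smul_sub, neg_mul]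
  module

/-- The middle vector of the quintuplet: 3J_z² - J² up to scale, with j = 2. -/
theorem isospinLaplacian_cartan_sq (h : IsMatrixUnits e) :
    isospinLaplacian e
      ((3 : ℂ) • ((e 0 0 - e 1 1) * (e 0 0 - e 1 1)) - isospinCasimir e) =
      (6 : ℂ) • ((3 : ℂ) • ((e 0 0 - e 1 1) * (e 0 0 - e 1 1)) - isospinCasimir e) := by
  simp [isospinLaplacian_apply, isospinCasimir, commutator_mul, h.commutator_unit]
  simp (decide := true) only [mul_sub, sub_mul, mul_add, add_mul, neg_mul, mul_neg, h.mul_swap,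
    reduceIte, sub_zero]
  module

/-- The j = 2 part of 3 ⊗ 3, of the form 3a_z b_z - a·b, where a·b is `doubletCubic` and a_z b_z is
half of the product of the diagonal components. -/
theorem isospinLaplacian_doublet_symmetric (h : IsMatrixUnits e) :
    isospinLaplacian e (doubletTriplet e * (e 0 0 - e 1 1) - doubletExchange e) =
      (6 : ℂ) • (doubletTriplet e * (e 0 0 - e 1 1) - doubletExchange e) := by
  simp [isospinLaplacian_apply, doubletTriplet, doubletExchange, commutator_mul,
    h.commutator_unit]
  simp only [mul_sub, sub_mul, mul_add, add_mul, smul_sub, neg_mul, mul_neg]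
  module

/-- A noncommutative Legendre polynomial with j = 3: 5J_z³ - 3J²J_z + J_z, rescaled by H = 2J_z. The
linear term is the ordering correction. -/
theorem isospinLaplacian_cartan_cube (h : IsMatrixUnits e) :
    isospinLaplacian e
      ((5 : ℂ) • ((e 0 0 - e 1 1) * (e 0 0 - e 1 1) * (e 0 0 - e 1 1)) -
        (3 : ℂ) • (isospinCasimir e * (e 0 0 - e 1 1)) + (4 : ℂ) • (e 0 0 - e 1 1)) =
      (12 : ℂ) • ((5 : ℂ) • ((e 0 0 - e 1 1) * (e 0 0 - e 1 1) * (e 0 0 - e 1 1)) -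
        (3 : ℂ) • (isospinCasimir e * (e 0 0 - e 1 1)) + (4 : ℂ) • (e 0 0 - e 1 1)) := by
  have hC := h.isospinLaplacian_isospinCasimir_mul
  have hH := h.isospinLaplacian_cartan
  rw [map_add, map_sub, map_smul, map_smul, map_smul, hC, hH]
  simp [isospinLaplacian_apply, isospinCasimir, commutator_mul, h.commutator_unit]
  simp (decide := true) only [mul_sub, sub_mul, mul_add, add_mul, neg_mul, mul_neg, mul_assoc,
    h.mul_swap, h.mul_swap_assoc, reduceIte, sub_zero, zero_sub, smul_mul_assoc]
  module

/-- Eight invariants, eight triplet vectors, three quintuplet vectors and one septuplet vector match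
the twenty monomials, and each monomial is solved for in terms of them. -/
theorem span_zeroWeightMonomials_le (h : IsMatrixUnits e) :
    Submodule.span ℂ (zeroWeightMonomials e) ≤
      Submodule.span ℂ (Set.range (invariants e)) ⊔ nonzeroPart (isospinLaplacian e) := by
  set Q := Submodule.span ℂ (Set.range (invariants e)) ⊔ nonzeroPart (isospinLaplacian e) with hQ
  have inv (n : Fin 8) : invariants e n ∈ Q :=
    Submodule.mem_sup_left (Submodule.subset_span ⟨n, rfl⟩)
  have eig {y : R} (μ : ℂ) (hμ : μ ≠ 0) (hy : isospinLaplacian e y = μ • y) : y ∈ Q :=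
    Submodule.mem_sup_right (mem_nonzeroPart μ hμ hy)
  -- A uniform three-term combination; when only two terms are needed the third is a dummy with
  -- coefficient 0.
  have comb {y u v w : R} (a b c : ℂ) (hu : u ∈ Q) (hv : v ∈ Q) (hw : w ∈ Q)
      (hy : y = a • u + b • v + c • w) : y ∈ Q :=
    hy ▸ add_mem (add_mem (Q.smul_mem _ hu) (Q.smul_mem _ hv)) (Q.smul_mem _ hw)
  have hH : e 0 0 - e 1 1 ∈ Q := eig 2 two_ne_zero h.isospinLaplacian_cartan
  have hHZ : (e 0 0 - e 1 1) * e 2 2 ∈ Q :=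
    eig 2 two_ne_zero (h.isospinLaplacian_mul_hypercharge h.isospinLaplacian_cartan)
  have hHZZ : (e 0 0 - e 1 1) * e 2 2 * e 2 2 ∈ Q :=
    eig 2 two_ne_zero (h.isospinLaplacian_mul_hypercharge
      (h.isospinLaplacian_mul_hypercharge h.isospinLaplacian_cartan))
  have hCH : isospinCasimir e * (e 0 0 - e 1 1) ∈ Q :=
    eig 2 two_ne_zero h.isospinLaplacian_isospinCasimir_mul
  have hKH : doubletQuadratic e * (e 0 0 - e 1 1) ∈ Q :=
    eig 2 two_ne_zero h.isospinLaplacian_doubletQuadratic_mul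
  have hQ1 : doubletTriplet e ∈ Q := eig 2 two_ne_zero h.isospinLaplacian_doubletTriplet
  have hQZ : doubletTriplet e * e 2 2 ∈ Q :=
    eig 2 two_ne_zero (h.isospinLaplacian_mul_hypercharge h.isospinLaplacian_doubletTriplet)
  have hA := eig 2 two_ne_zero h.isospinLaplacian_antisymmetric
  have hT := eig 6 (by norm_num) h.isospinLaplacian_cartan_sq
  have hTZ := eig 6 (by norm_num)
    (h.isospinLaplacian_mul_hypercharge h.isospinLaplacian_cartan_sq)
  have hS := eig 6 (by norm_num) h.isospinLaplacian_doublet_symmetric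
  have hHHH' := eig 12 (by norm_num) h.isospinLaplacian_cartan_cube
  have hHH : (e 0 0 - e 1 1) * (e 0 0 - e 1 1) ∈ Q :=
    comb (1 / 3) (1 / 3) 0 hT (inv 3) hH (by
      simp only [invariants, Matrix.cons_val]
      module)
  have hHHZ : (e 0 0 - e 1 1) * (e 0 0 - e 1 1) * e 2 2 ∈ Q :=
    comb (1 / 3) (1 / 3) 0 hTZ (inv 4) hH (by
      simp only [invariants, Matrix.cons_val, sub_mul _ (isospinCasimir e), smul_mul_assoc]
      module)
  have hHHH : (e 0 0 - e 1 1) * (e 0 0 - e 1 1) * (e 0 0 - e 1 1) ∈ Q :=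
    comb (1 / 5) (3 / 5) (-4 / 5) hHHH' hCH hH (by module)
  have hFE : e 1 0 * e 0 1 ∈ Q :=
    comb (1 / 4) (-1 / 4) (-1 / 2) (inv 3) hHH hH (by
      simp only [invariants, Matrix.cons_val, isospinCasimir]
      module)
  have hFEZ : e 1 0 * e 0 1 * e 2 2 ∈ Q :=
    comb (1 / 4) (-1 / 4) (-1 / 2) (inv 4) hHHZ hHZ (by
      simp only [invariants, Matrix.cons_val, isospinCasimir, add_mul, smul_mul_assoc]
      module)
  have hFEH : e 1 0 * e 0 1 * (e 0 0 - e 1 1) ∈ Q :=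
    comb (1 / 4) (-1 / 4) (-1 / 2) hCH hHHH hHH (by
      simp only [isospinCasimir, add_mul, smul_mul_assoc]
      module)
  have hQH : doubletTriplet e * (e 0 0 - e 1 1) ∈ Q :=
    comb (2 / 3) (2 / 3) 0 (inv 7) hS hH (by
      simp only [invariants, Matrix.cons_val, doubletCubic]
      module)
  have hX : doubletExchange e ∈ Q :=
    comb 1 (-1 / 2) 0 (inv 7) hQH hH (by
      simp only [invariants, Matrix.cons_val, doubletCubic]
      module)
  -- Exhaustive enumeration of the zero weight monomials: 2 linear, 6 quadratic and 12 cubic ones.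
  have z1 : ∀ i : Fin 8, basisWeight i = 0 → i ∈ ([6, 7] : List (Fin 8)) := by decide
  have z2 : ∀ i j : Fin 8, i ≤ j → basisWeight i + basisWeight j = 0 → (i, j) ∈
      ([(6, 6), (6, 7), (7, 7), (4, 5), (0, 2), (1, 3)] : List (Fin 8 × Fin 8)) := by decide
  have z3 : ∀ i j k : Fin 8, i ≤ j → j ≤ k → basisWeight i + basisWeight j + basisWeight k = 0 →
      (i, j, k) ∈ ([(6, 6, 6), (6, 6, 7), (6, 7, 7), (7, 7, 7), (4, 5, 6), (4, 5, 7), (0, 2, 6),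
        (0, 2, 7), (1, 3, 6), (1, 3, 7), (0, 3, 4), (1, 2, 5)] :
          List (Fin 8 × Fin 8 × Fin 8)) := by decide
  refine Submodule.span_le.2 ?_
  rintro _ (⟨i, hw, rfl⟩ | ⟨i, j, hij, hw, rfl⟩ | ⟨i, j, k, hij, hjk, hw, rfl⟩)
  · have := z1 i hw
    simp only [List.mem_cons, List.not_mem_nil, or_false] at this
    rcases this with rfl | rfl
    exacts [hH, inv 0]
  · have := z2 i j hij hw
    simp only [List.mem_cons, List.not_mem_nil, or_false, Prod.mk.injEq] at this
    rcases this with ⟨rfl, rfl⟩ | ⟨rfl, rfl⟩ | ⟨rfl, rfl⟩ | ⟨rfl, rfl⟩ | ⟨rfl, rfl⟩ | ⟨rfl, rfl⟩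
    · exact hHH
    · exact hHZ
    · exact inv 1
    · exact hFE
    · exact comb (1 / 2) (1 / 2) 0 (inv 5) hQ1 hH (by
        simp only [orderedBasis, invariants, Matrix.cons_val, doubletQuadratic, doubletTriplet]
        module)
    · exact comb (1 / 2) (-1 / 2) 0 (inv 5) hQ1 hH (by
        simp only [orderedBasis, invariants, Matrix.cons_val, doubletQuadratic, doubletTriplet]
        module)
  · have := z3 i j k hij hjk hw
    simp only [List.mem_cons, List.not_mem_nil, or_false, Prod.mk.injEq] at this
    rcases this with ⟨rfl, rfl, rfl⟩ | ⟨rfl, rfl, rfl⟩ | ⟨rfl, rfl, rfl⟩ | ⟨rfl, rfl, rfl⟩ |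
      ⟨rfl, rfl, rfl⟩ | ⟨rfl, rfl, rfl⟩ | ⟨rfl, rfl, rfl⟩ | ⟨rfl, rfl, rfl⟩ | ⟨rfl, rfl, rfl⟩ |
      ⟨rfl, rfl, rfl⟩ | ⟨rfl, rfl, rfl⟩ | ⟨rfl, rfl, rfl⟩
    · exact hHHH
    · exact hHHZ
    · exact hHZZ
    · exact inv 2
    · exact hFEH
    · exact hFEZ
    · exact comb (1 / 2) (1 / 2) 0 hKH hQH hH (by
        simp only [orderedBasis, Matrix.cons_val, doubletQuadratic, doubletTriplet, add_mul,
          sub_mul (e 0 2 * e 2 0)]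
        module)
    · exact comb (1 / 2) (1 / 2) 0 (inv 6) hQZ hH (by
        simp only [orderedBasis, invariants, Matrix.cons_val, doubletQuadratic, doubletTriplet,
          add_mul, sub_mul]
        module)
    · exact comb (1 / 2) (-1 / 2) 0 hKH hQH hH (by
        simp only [orderedBasis, Matrix.cons_val, doubletQuadratic, doubletTriplet, add_mul,
          sub_mul (e 0 2 * e 2 0)]
        module)
    · exact comb (1 / 2) (-1 / 2) 0 (inv 6) hQZ hH (by
        simp only [orderedBasis, invariants, Matrix.cons_val, doubletQuadratic, doubletTriplet,
          add_mul, sub_mul]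
        module)
    · exact comb (1 / 2) (1 / 2) 0 hX hA hH (by
        simp only [orderedBasis, Matrix.cons_val, doubletExchange]
        module)
    · exact comb (1 / 2) (-1 / 2) 0 hX hA hH (by
        simp only [orderedBasis, Matrix.cons_val, doubletExchange]
        module)

theorem mem_span_invariants (h : IsMatrixUnits e) {z : R}
    (hz : z ∈ linearSpan e ⊔ linearSpan e ^ 2 ⊔ linearSpan e ^ 3)
    (hE : commutator (e 0 1) z = 0) (hH : commutator (e 1 1) z = 0)
    (hZ : commutator (e 2 2) z = 0) :
    ∃ c : Fin 8 → ℂ, ∑ n, c n • invariants e n = z := by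
  rw [← Submodule.mem_span_range_iff_exists_fun ℂ]
  have hz' : z ∈ orderedCubic e :=
    sup_le (sup_le (le_sup_left.trans le_sup_left) (h.sq_linearSpan_le.trans le_sup_left))
      h.cube_linearSpan_le hz
  have h0 : z ∈ Submodule.span ℂ (zeroWeightMonomials e) := by
    refine mem_of_mem_sup_nonzeroPart (fun v hv => h.commutator_zeroWeightMonomials hv)
      (h.orderedCubic_le hz') ?_
    rw [commutator_eq_zero_iff] at hH hZ ⊢
    rw [add_mul, mul_add, smul_mul_assoc, mul_smul_comm, hH, hZ]
  refine mem_of_mem_sup_nonzeroPart (fun v hv => ?_) (h.span_zeroWeightMonomials_le h0) ?_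
  · induction hv using Submodule.span_induction with
    | zero => simp
    | add a b _ _ ha hb => rw [map_add, ha, hb, add_zero]
    | smul c a _ ha => rw [map_smul, ha, smul_zero]
    | mem a ha =>
      obtain ⟨n, rfl⟩ := ha
      rw [isospinLaplacian_apply, h.commutator_invariants (by decide), map_zero]
  · rw [isospinLaplacian_apply, hE, map_zero]

/-! ### Normal forms of the cubic invariant, Ω₂ and Ω₃ -/

/-- Reversing every product gives the same element because the commutator corrections cancel; this
is what makes `doubletCubic` fixed by †. -/
theorem reverse_doubletCubic (h : IsMatrixUnits e) :
    (1 / 2 : ℂ) • ((e 0 0 - e 1 1) * doubletTriplet e) +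
      (e 0 1 * (e 1 2 * e 2 0) + e 1 0 * (e 0 2 * e 2 1)) = doubletCubic e := by
  simp only [doubletCubic, doubletTriplet, doubletExchange]
  simp (decide := true) only [mul_sub, sub_mul, mul_add, add_mul, neg_mul, mul_neg, mul_assoc,
    h.mul_swap, h.mul_swap_assoc, reduceIte, sub_zero, add_zero, zero_sub, zero_mul]
  module

theorem quadratic_normalForm (h : IsMatrixUnits e) (ℓ : ℕ → R) (h1 : ℓ 1 = e 0 1 + e 1 0)
    (h2 : ℓ 2 = -Complex.I • (e 0 1 - e 1 0)) (h3 : ℓ 3 = e 0 0 - e 1 1)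
    (h4 : ℓ 4 = e 0 2 + e 2 0) (h5 : ℓ 5 = -Complex.I • (e 0 2 - e 2 0))
    (h6 : ℓ 6 = e 1 2 + e 2 1) (h7 : ℓ 7 = -Complex.I • (e 1 2 - e 2 1))
    (h8 : ℓ 8 = -((√3 : ℝ) : ℂ) • e 2 2) (α β γ : ℂ) :
    (1 / 12 : ℂ) •
      (α • (ℓ 1 * ℓ 1 + ℓ 2 * ℓ 2 + ℓ 3 * ℓ 3) +
        β • (ℓ 4 * ℓ 4 + ℓ 5 * ℓ 5 + ℓ 6 * ℓ 6 + ℓ 7 * ℓ 7) +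
        γ • (ℓ 8 * ℓ 8)) =
    (α / 12) • isospinCasimir e + (β / 3) • doubletQuadratic e + (β / 2) • e 2 2 +
      (γ / 4) • (e 2 2 * e 2 2) := by
  rw [h1, h2, h3, h4, h5, h6, h7, h8]
  simp only [smul_mul_smul_comm, neg_mul_neg, Complex.I_mul_I, sqrt_three_mul_self,
    isospinCasimir, doubletQuadratic]
  simp (decide := true) only [mul_sub, sub_mul, mul_add, add_mul, neg_mul, mul_neg,
    h.mul_swap, reduceIte, sub_zero, add_zero, h.unit_zero_zero]
  module

theorem cubic_normalForm (h : IsMatrixUnits e) (ℓ : ℕ → R) (h1 : ℓ 1 = e 0 1 + e 1 0)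
    (h2 : ℓ 2 = -Complex.I • (e 0 1 - e 1 0)) (h3 : ℓ 3 = e 0 0 - e 1 1)
    (h4 : ℓ 4 = e 0 2 + e 2 0) (h5 : ℓ 5 = -Complex.I • (e 0 2 - e 2 0))
    (h6 : ℓ 6 = e 1 2 + e 2 1) (h7 : ℓ 7 = -Complex.I • (e 1 2 - e 2 1))
    (h8 : ℓ 8 = -((√3 : ℝ) : ℂ) • e 2 2) (A B C U V : ℂ) :
    (1 / 72 : ℂ) •
      ((6 * ((√3 : ℝ) : ℂ) * A) • (ℓ 1 * ℓ 1 * ℓ 8 + ℓ 2 * ℓ 2 * ℓ 8 + ℓ 3 * ℓ 3 * ℓ 8) -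
        (3 * ((√3 : ℝ) : ℂ) * B) •
          (ℓ 4 * ℓ 4 * ℓ 8 + ℓ 5 * ℓ 5 * ℓ 8 + ℓ 6 * ℓ 6 * ℓ 8 + ℓ 7 * ℓ 7 * ℓ 8) -
        (2 * ((√3 : ℝ) : ℂ) * C) • (ℓ 8 * ℓ 8 * ℓ 8) +
        (9 * U) •
          ((2 : ℂ) • (ℓ 1 * ℓ 4 * ℓ 6) + (2 : ℂ) • (ℓ 1 * ℓ 5 * ℓ 7) -
            (2 : ℂ) • (ℓ 2 * ℓ 4 * ℓ 7) + (2 : ℂ) • (ℓ 2 * ℓ 5 * ℓ 6) +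
            ℓ 3 * ℓ 4 * ℓ 4 + ℓ 3 * ℓ 5 * ℓ 5 - ℓ 3 * ℓ 6 * ℓ 6 - ℓ 3 * ℓ 7 * ℓ 7 +
            (4 : ℂ) • ℓ 3) -
        (12 * V * ((√3 : ℝ) : ℂ)) • ℓ 8) =
    U • doubletCubic e - (U / 4) • isospinCasimir e - (A / 4) • (isospinCasimir e * e 2 2) +
      (B / 2) • (doubletQuadratic e * e 2 2) + (3 / 4 * B) • (e 2 2 * e 2 2) +
      (C / 4) • (e 2 2 * e 2 2 * e 2 2) + (V / 2) • e 2 2 := by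
  have hs : ((√3 : ℝ) : ℂ) ^ 2 = 3 := by rw [sq, sqrt_three_mul_self]
  -- The fourth power arises in the `C` term: one √3 from its coefficient and three from the cube of
  -- ℓ₈.
  have hs4 : ((√3 : ℝ) : ℂ) ^ 4 = 9 := by
    linear_combination (((√3 : ℝ) : ℂ) ^ 2 + 3) * hs
  rw [h1, h2, h3, h4, h5, h6, h7, h8]
  simp only [smul_mul_assoc, mul_smul_comm, smul_smul, neg_mul, mul_neg, neg_neg, Complex.I_mul_I,
    isospinCasimir, doubletQuadratic, doubletCubic, doubletTriplet, doubletExchange]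
  simp (decide := true) only [mul_sub, sub_mul, mul_add, add_mul, neg_mul, mul_neg, mul_assoc,
    h.mul_swap, h.mul_swap_assoc, reduceIte, sub_zero, add_zero, zero_sub, h.unit_zero_zero,
    zero_mul, smul_mul_assoc]
  match_scalars <;> ring_nf <;> (try simp only [hs, hs4]) <;> ring

end IsMatrixUnits

end MatrixUnits

/-! ### Classification of invariant and self-adjoint cubic elements -/

theorem isMatrixUnits_unit : IsMatrixUnits unit := ⟨unit_mul_sub, unit_trace⟩

theorem generators_eq_linearSpan : generators = linearSpan unit := by
  rw [isMatrixUnits_unit.linearSpan_eq, generators_eq_range]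
  apply le_antisymm
  · rintro _ ⟨M, rfl⟩
    rw [complexIncl_eq_sum]
    exact sum_mem fun i _ => sum_mem fun j _ =>
      Submodule.smul_mem _ _ (Submodule.subset_span ⟨(i, j), rfl⟩)
  · refine Submodule.span_le.2 ?_
    rintro _ ⟨p, rfl⟩
    exact ⟨_, rfl⟩

theorem invariants_mem_cubicElements (n : Fin 8) : invariants unit n ∈ cubicElements := by
  have g1 {x : Env} (hx : x ∈ generators) : x ∈ cubicElements :=
    Submodule.mem_sup_left (Submodule.mem_sup_left hx)
  have g2 {x y : Env} (hx : x ∈ generators) (hy : y ∈ generators) : x * y ∈ cubicElements :=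
    Submodule.mem_sup_left (Submodule.mem_sup_right (sq generators ▸ Submodule.mul_mem_mul hx hy))
  have g3 {x y z : Env} (hx : x ∈ generators) (hy : y ∈ generators) (hz : z ∈ generators) :
      x * y * z ∈ cubicElements :=
    Submodule.mem_sup_right (pow_three' generators ▸
      Submodule.mul_mem_mul (Submodule.mul_mem_mul hx hy) hz)
  have u := unit_mem_generators
  have hH := sub_mem (u 0 0) (u 1 1)
  fin_cases n
  · exact g1 (u _ _)
  · exact g2 (u _ _) (u _ _)
  · exact g3 (u _ _) (u _ _) (u _ _)
  · exact add_mem (add_mem (g2 hH hH) (Submodule.smul_mem _ _ (g1 hH)))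
      (Submodule.smul_mem _ _ (g2 (u _ _) (u _ _)))
  · change (_ + _ + _) * _ ∈ _
    rw [add_mul, add_mul, smul_mul_assoc, smul_mul_assoc]
    exact add_mem (add_mem (g3 hH hH (u _ _)) (Submodule.smul_mem _ _ (g2 hH (u _ _))))
      (Submodule.smul_mem _ _ (g3 (u _ _) (u _ _) (u _ _)))
  · exact add_mem (g2 (u _ _) (u _ _)) (g2 (u _ _) (u _ _))
  · change (_ + _) * _ ∈ _
    rw [add_mul]
    exact add_mem (g3 (u _ _) (u _ _) (u _ _)) (g3 (u _ _) (u _ _) (u _ _))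
  · refine add_mem (Submodule.smul_mem _ _ ?_)
      (add_mem (g3 (u _ _) (u _ _) (u _ _)) (g3 (u _ _) (u _ _) (u _ _)))
    rw [doubletTriplet, sub_mul]
    exact sub_mem (g3 (u _ _) (u _ _) hH) (g3 (u _ _) (u _ _) hH)

theorem ladder_one_two : ladder 1 2 = unit 0 1 := by
  rw [ladder, L_one, L_two, smul_smul, mul_neg, Complex.I_mul_I]
  module

theorem ladder_six_seven : ladder 6 7 = unit 1 2 := by
  rw [ladder, L_six, L_seven, smul_smul, mul_neg, Complex.I_mul_I]
  module

theorem sqrt_three_smul_L_eight : ((√3 : ℝ) : ℂ) • L 8 = (-3 : ℂ) • unit 2 2 := by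
  rw [L_eight, smul_smul, mul_neg, sqrt_three_mul_self]

theorem h2_eq : h2 = unit 1 1 - unit 2 2 := by
  rw [h2, sqrt_three_smul_L_eight, L_three, isMatrixUnits_unit.unit_zero_zero]
  module

theorem commutator_eq_zero_iff_mem_centralizer {x z : Env} :
    commutator x z = 0 ↔ x ∈ Subalgebra.centralizer ℂ {z} := by
  rw [commutator_eq_zero_iff, Subalgebra.mem_centralizer_iff]
  simp [eq_comm]

theorem commutesWithU2_iff (z : Env) : CommutesWithU2 z ↔
    ∀ i j : Fin 3, (i = 2 ∧ j = 2 ∨ i ≠ 2 ∧ j ≠ 2) → commutator (unit i j) z = 0 := by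
  simp only [CommutesWithU2, u2Indices, ← commutator_eq_zero_iff,
    commutator_eq_zero_iff_mem_centralizer]
  set S := Subalgebra.centralizer ℂ {z}
  constructor
  · intro h
    have h1 := h 1 (by simp)
    have h2 := h 2 (by simp)
    have h3 := h 3 (by simp)
    have h8 := S.smul_mem (h 8 (by simp)) ((√3 : ℝ) : ℂ)
    rw [sqrt_three_smul_L_eight] at h8
    have e01 : unit 0 1 ∈ S := by
      rw [← ladder_one_two]
      exact S.smul_mem (add_mem h1 (S.smul_mem h2 _)) _
    have e10 : unit 1 0 ∈ S := by
      rw [L_one] at h1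
      exact (add_mem_cancel_left e01).1 h1
    have e22 : unit 2 2 ∈ S := by
      convert S.smul_mem h8 (-1 / 3) using 1
      module
    -- By the trace relation, L₃ + e₂₂ = -2e₁₁.
    have e11 : unit 1 1 ∈ S := by
      convert S.smul_mem (add_mem h3 e22) (-1 / 2) using 1
      rw [L_three, isMatrixUnits_unit.unit_zero_zero]
      module
    have e00 : unit 0 0 ∈ S := by
      rw [isMatrixUnits_unit.unit_zero_zero]
      exact sub_mem (neg_mem e11) e22
    intro i j hij
    fin_cases i <;> fin_cases j <;> simp at hij <;> assumption
  · intro h a ha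
    have e00 := h 0 0 (by decide)
    have e01 := h 0 1 (by decide)
    have e10 := h 1 0 (by decide)
    have e11 := h 1 1 (by decide)
    have e22 := h 2 2 (by decide)
    rcases ha with rfl | rfl | rfl | rfl
    · exact L_one ▸ add_mem e01 e10
    · exact L_two ▸ S.smul_mem (sub_mem e01 e10) _
    · exact L_three ▸ sub_mem e00 e11
    · exact L_eight ▸ S.smul_mem e22 _

theorem Omega2_eq (α β γ : ℂ) : Omega2 α β γ =
    (α / 12) • isospinCasimir unit + (β / 3) • doubletQuadratic unit + (β / 2) • unit 2 2 +
      (γ / 4) • (unit 2 2 * unit 2 2) :=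
  isMatrixUnits_unit.quadratic_normalForm L L_one L_two L_three L_four L_five L_six L_seven L_eight
    α β γ

theorem Omega3_eq (A B C U V : ℂ) : Omega3 A B C U V =
    U • doubletCubic unit - (U / 4) • isospinCasimir unit -
      (A / 4) • (isospinCasimir unit * unit 2 2) + (B / 2) • (doubletQuadratic unit * unit 2 2) +
      (3 / 4 * B) • (unit 2 2 * unit 2 2) + (C / 4) • (unit 2 2 * unit 2 2 * unit 2 2) +
      (V / 2) • unit 2 2 :=
  isMatrixUnits_unit.cubic_normalForm L L_one L_two L_three L_four L_five L_six L_seven L_eight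
    A B C U V

theorem Omega3_add_smul_Omega2 (A B C U V x α β γ : ℂ) :
    Omega3 A B C U V + (9 * x) • Omega2 α β γ =
      ∑ n, ![V / 2 + 9 / 2 * x * β, 3 / 4 * B + 9 / 4 * x * γ, C / 4, -U / 4 + 3 / 4 * x * α,
        -A / 4, 3 * x * β, B / 2, U] n • invariants unit n := by
  rw [Omega2_eq, Omega3_eq, Fin.sum_univ_eight]
  simp only [invariants, Matrix.cons_val]
  module

/-- Inverts the triangular coefficient formula of `Omega3_add_smul_Omega2` after normalising x = 1:
the cubic coefficients and that of `doubletQuadratic` give A, B, C, U and β, and the remaining three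
give α, γ and V. -/
theorem sum_smul_invariants (c : Fin 8 → ℂ) : ∑ n, c n • invariants unit n =
    Omega3 (-4 * c 4) (2 * c 6) (4 * c 2) (c 7) (2 * c 0 - 3 * c 5) +
      (9 * 1 : ℂ) • Omega2 (4 / 3 * c 3 + c 7 / 3) (c 5 / 3) (4 / 9 * c 1 - 2 / 3 * c 6) := by
  rw [Omega3_add_smul_Omega2, Fin.sum_univ_eight, Fin.sum_univ_eight]
  simp only [Matrix.cons_val]
  module

theorem adjoint_invariants (n : Fin 8) : adjoint (invariants unit n) = invariants unit n := by
  have hr := isMatrixUnits_unit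
  have conj2 : (starRingEnd ℂ) 2 = 2 := map_ofNat _ 2
  have conj4 : (starRingEnd ℂ) 4 = 4 := map_ofNat _ 4
  have hC : adjoint (isospinCasimir unit) = isospinCasimir unit := by
    simp [isospinCasimir, adjoint_mul, adjoint_smul, adjoint_unit, conj2, conj4]
  have hK : adjoint (doubletQuadratic unit) = doubletQuadratic unit := by
    simp [doubletQuadratic, adjoint_mul, adjoint_unit]
  have hCZ := commutator_eq_zero_iff.1
    (hr.commutator_isospinCasimir (i := 2) (j := 2) (by decide))
  have hKZ := commutator_eq_zero_iff.1
    (hr.commutator_doubletQuadratic (i := 2) (j := 2) (by decide))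
  fin_cases n
  · exact adjoint_unit _ _
  · simp [invariants, adjoint_mul, adjoint_unit]
  · simp [invariants, adjoint_mul, adjoint_unit, mul_assoc]
  · exact hC
  · simp [invariants, adjoint_mul, adjoint_unit, hC, hCZ]
  · exact hK
  · simp [invariants, adjoint_mul, adjoint_unit, hK, hKZ]
  · change adjoint (doubletCubic unit) = doubletCubic unit
    conv_rhs => rw [← hr.reverse_doubletCubic]
    simp [doubletCubic, doubletTriplet, doubletExchange, adjoint_mul, adjoint_smul,
      adjoint_unit, conj2]

theorem mem_cubicElements_and_commutesWithU2_iff (z : Env) :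
    z ∈ cubicElements ∧ CommutesWithU2 z ↔ ∃ c : Fin 8 → ℂ, ∑ n, c n • invariants unit n = z := by
  constructor
  · rintro ⟨hz, hc⟩
    rw [commutesWithU2_iff] at hc
    rw [cubicElements, generators_eq_linearSpan] at hz
    exact isMatrixUnits_unit.mem_span_invariants hz (hc 0 1 (by decide)) (hc 1 1 (by decide))
      (hc 2 2 (by decide))
  · rintro ⟨c, rfl⟩
    refine ⟨sum_mem fun n _ => Submodule.smul_mem _ _ (invariants_mem_cubicElements n), ?_⟩
    rw [commutesWithU2_iff]
    intro i j hij
    simp [isMatrixUnits_unit.commutator_invariants hij]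

theorem cubic_commutesWithU2_iff (z : Env) :
    (z ∈ cubicElements ∧ CommutesWithU2 z) ↔
      ∃ A B C U V x α β γ : ℂ, z = Omega3 A B C U V + (9 * x) • Omega2 α β γ := by
  rw [mem_cubicElements_and_commutesWithU2_iff]
  constructor
  · rintro ⟨c, rfl⟩
    exact ⟨_, _, _, _, _, _, _, _, _, sum_smul_invariants c⟩
  · rintro ⟨A, B, C, U, V, x, α, β, γ, rfl⟩
    exact ⟨_, (Omega3_add_smul_Omega2 A B C U V x α β γ).symm⟩

theorem adjoint_sum_smul_invariants (c : Fin 8 → ℂ) :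
    adjoint (∑ n, c n • invariants unit n) =
      ∑ n, (starRingEnd ℂ) (c n) • invariants unit n := by
  rw [map_sum]
  exact Finset.sum_congr rfl fun n _ => by rw [adjoint_smul, adjoint_invariants]

theorem cubic_commutesWithU2_selfAdjoint_iff (z : Env) :
    (z ∈ cubicElements ∧ CommutesWithU2 z ∧ adjoint z = z) ↔
      ∃ A B C U V x α β γ : ℝ, z = Omega3 A B C U V + (9 * x : ℂ) • Omega2 α β γ := by
  rw [← and_assoc, mem_cubicElements_and_commutesWithU2_iff]
  constructor
  · rintro ⟨⟨c, hc⟩, hz⟩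
    have hre : z = ∑ n, ((c n).re : ℂ) • invariants unit n := by
      -- Write 2z = z + z†. The coefficients of z need not be unique, but their real parts represent
      -- z as well.
      have h2 : (2 : ℂ) • z = (2 : ℂ) • ∑ n, ((c n).re : ℂ) • invariants unit n := by
        rw [two_smul]
        nth_rewrite 2 [← hz]
        rw [← hc, adjoint_sum_smul_invariants, ← Finset.sum_add_distrib, Finset.smul_sum]
        refine Finset.sum_congr rfl fun n _ => ?_
        rw [← add_smul, smul_smul, Complex.add_conj]
        push_cast
        rfl
      exact smul_right_injective _ (two_ne_zero' ℂ) h2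
    refine ⟨-4 * (c 4).re, 2 * (c 6).re, 4 * (c 2).re, (c 7).re, 2 * (c 0).re - 3 * (c 5).re, 1,
      4 / 3 * (c 3).re + (c 7).re / 3, (c 5).re / 3, 4 / 9 * (c 1).re - 2 / 3 * (c 6).re, ?_⟩
    rw [hre, sum_smul_invariants]
    push_cast
    rfl
  · rintro ⟨A, B, C, U, V, x, α, β, γ, rfl⟩
    rw [Omega3_add_smul_Omega2]
    refine ⟨⟨_, rfl⟩, ?_⟩
    rw [adjoint_sum_smul_invariants]
    refine Finset.sum_congr rfl fun n _ => ?_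
    congr 1
    fin_cases n <;> simp [map_ofNat]

/-! ### Eigenvalues in representations -/

section Representations

variable {E : Type*} [AddCommGroup E] [Module ℂ E]

theorem act_incl (ρ : su3 →ₗ⁅ℝ⁆ Module.End ℂ E) (X : su3) : act ρ (incl X) = ρ X := by
  simp [act, incl]

/-- Schur's lemma with the eigenvector given: the eigenspace of a central element is a nonzero
subrepresentation, hence everything. -/
theorem act_eq_smul_of_central {ρ : su3 →ₗ⁅ℝ⁆ Module.End ℂ E} {o₁ o₂ : ℕ} (h : IsIrrep ρ o₁ o₂)
    {z : Env} (hz : ∀ i j, commutator (unit i j) z = 0) {c : ℂ} {v : E} (hv0 : v ≠ 0)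
    (hv : act ρ z v = c • v) (w : E) : act ρ z w = c • w := by
  have hX (X : su3) : incl X * z = z * incl X := by
    rw [← commutator_eq_zero_iff, commutator_eq_zero_iff_mem_centralizer, ← complexIncl_coe,
      complexIncl_eq_sum]
    exact sum_mem fun i _ => sum_mem fun j _ => Subalgebra.smul_mem _
      (commutator_eq_zero_iff_mem_centralizer.1 (hz i j)) _
  rw [← Module.End.mem_eigenspace_iff] at hv ⊢
  have stable (X : su3) (w : E) (hw : w ∈ (act ρ z).eigenspace c) :
      ρ X w ∈ (act ρ z).eigenspace c := by
    rw [Module.End.mem_eigenspace_iff] at hw ⊢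
    rw [← act_incl, ← Module.End.mul_apply, ← map_mul, ← hX, map_mul, Module.End.mul_apply, hw,
      map_smul]
  rcases h.irreducible _ stable with hS | hS
  · rw [hS, Submodule.mem_bot] at hv
    exact absurd hv hv0
  · rw [hS]
    exact Submodule.mem_top

theorem act_eq_smul_of_commutesWithU2 {ρ : su3 →ₗ⁅ℝ⁆ Module.End ℂ E} {W : Submodule ℂ E}
    {I Y : ℝ} (h : IsU2Component ρ W I Y) {z : Env} (hz : CommutesWithU2 z) {c : ℂ} {v : E}
    (hvW : v ∈ W) (hv0 : v ≠ 0) (hv : act ρ z v = c • v) {w : E} (hw : w ∈ W) :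
    act ρ z w = c • w := by
  have hv' : v ∈ W ⊓ (act ρ z).eigenspace c := ⟨hvW, Module.End.mem_eigenspace_iff.2 hv⟩
  have stable : IsU2Stable ρ (W ⊓ (act ρ z).eigenspace c) := by
    intro a ha u hu
    have hu2 := Module.End.mem_eigenspace_iff.1 hu.2
    refine ⟨h.stable a ha u hu.1, ?_⟩
    rw [SetLike.mem_coe, Module.End.mem_eigenspace_iff, ← Module.End.mul_apply, ← map_mul,
      ← hz a ha, map_mul, Module.End.mul_apply, hu2, map_smul]
  rcases h.irreducible _ inf_le_left stable with hS | hS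
  · rw [hS, Submodule.mem_bot] at hv'
    exact absurd hv' hv0
  · rw [← hS] at hw
    exact Module.End.mem_eigenspace_iff.1 hw.2

/-- The action of the matrix units on a highest weight vector. -/
theorem act_unit_highest {ρ : su3 →ₗ⁅ℝ⁆ Module.End ℂ E} {o₁ o₂ : ℕ} {v : E}
    (hE : act ρ (ladder 1 2) v = 0) (hb : act ρ (ladder 6 7) v = 0)
    (h1v : act ρ h1 v = (o₁ : ℂ) • v) (h2v : act ρ h2 v = (o₂ : ℂ) • v) :
    act ρ (unit 0 1) v = 0 ∧ act ρ (unit 1 2) v = 0 ∧ act ρ (unit 0 2) v = 0 ∧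
      act ρ (unit 1 1) v = (((o₂ : ℂ) - o₁) / 3) • v ∧
      act ρ (unit 2 2) v = (-((o₁ : ℂ) + 2 * o₂) / 3) • v := by
  rw [ladder_one_two] at hE
  rw [ladder_six_seven] at hb
  rw [h1, L_three, isMatrixUnits_unit.unit_zero_zero] at h1v
  rw [h2_eq] at h2v
  simp only [map_sub, map_neg, LinearMap.sub_apply, LinearMap.neg_apply] at h1v h2v
  refine ⟨hE, hb, ?_, ?_, ?_⟩
  · have : unit 0 2 = unit 0 1 * unit 1 2 - unit 1 2 * unit 0 1 := by simp [unit_mul_sub]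
    rw [this]
    simp [hE, hb]
  -- The diagonal weights solve e₀₀ - e₁₁ = o₁, e₁₁ - e₂₂ = o₂ with zero trace.
  · linear_combination (norm := module) (-1 / 3 : ℂ) • h1v + (1 / 3 : ℂ) • h2v
  · linear_combination (norm := module) (-1 / 3 : ℂ) • h1v - (2 / 3 : ℂ) • h2v

theorem act_quadraticCasimir {ρ : su3 →ₗ⁅ℝ⁆ Module.End ℂ E} {o₁ o₂ : ℕ} (h : IsIrrep ρ o₁ o₂)
    (w : E) : act ρ (quadraticCasimir unit) w = C2 o₁ o₂ • w := by
  have hr := isMatrixUnits_unit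
  obtain ⟨v, hv0, hE, hb, h1v, h2v⟩ := h.highest
  obtain ⟨e01, e12, e02, e11, e22⟩ := act_unit_highest hE hb h1v h2v
  refine act_eq_smul_of_central h hr.commutator_quadraticCasimir hv0 ?_ w
  simp only [quadraticCasimir, isospinCasimir, doubletQuadratic]
  simp (decide := true) only [mul_sub, sub_mul, hr.mul_swap, reduceIte, sub_zero,
    hr.unit_zero_zero]
  simp only [map_add, map_sub, map_neg, map_smul, map_mul, LinearMap.add_apply,
    LinearMap.sub_apply, LinearMap.neg_apply, LinearMap.smul_apply, Module.End.mul_apply, e01, e12,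
    e02, e11, e22, map_zero, LinearMap.zero_apply, C2]
  module

/-- In normal order every term with a raising operator kills the highest weight vector, so only a
polynomial in the diagonal weights survives. -/
theorem act_cubicCasimir {ρ : su3 →ₗ⁅ℝ⁆ Module.End ℂ E} {o₁ o₂ : ℕ} (h : IsIrrep ρ o₁ o₂)
    (w : E) : act ρ (cubicCasimir unit) w = C3 o₁ o₂ • w := by
  have hr := isMatrixUnits_unit
  obtain ⟨v, hv0, hE, hb, h1v, h2v⟩ := h.highest
  obtain ⟨e01, e12, e02, e11, e22⟩ := act_unit_highest hE hb h1v h2v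
  refine act_eq_smul_of_central h hr.commutator_cubicCasimir hv0 ?_ w
  simp only [cubicCasimir, isospinCasimir, doubletQuadratic, doubletCubic, doubletTriplet,
    doubletExchange]
  simp (decide := true) only [mul_sub, sub_mul, mul_add, add_mul, mul_assoc,
    hr.mul_swap, hr.mul_swap_assoc, reduceIte, sub_zero, zero_sub, hr.unit_zero_zero,
    smul_mul_assoc]
  simp only [map_add, map_sub, map_neg, map_smul, map_mul, LinearMap.add_apply,
    LinearMap.sub_apply, LinearMap.neg_apply, LinearMap.smul_apply, Module.End.mul_apply, e01, e12,
    e02, e11, e22, map_zero, LinearMap.zero_apply, C3]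
  module

/-- The doublet invariants are eliminated: `doubletCubic` by the cubic Casimir element,
`doubletQuadratic` by the quadratic one. What remains acts by isospin and hypercharge alone. -/
theorem Omega3_eq_casimir (A B C U V : ℂ) : Omega3 A B C U V =
    U • cubicCasimir unit + (3 / 2 * (B - U)) • (quadraticCasimir unit * unit 2 2) -
      ((2 * A + B - 3 * U) / 8) • (isospinCasimir unit * unit 2 2) -
      ((3 * B - 2 * C - U) / 8) • (unit 2 2 * unit 2 2 * unit 2 2) +
      ((V - U) / 2) • unit 2 2 := by
  rw [Omega3_eq, cubicCasimir, quadraticCasimir]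
  simp only [add_mul, smul_mul_assoc]
  module

theorem act_Omega3 {ρ : su3 →ₗ⁅ℝ⁆ Module.End ℂ E} {o₁ o₂ : ℕ} {W : Submodule ℂ E} {I Y : ℝ}
    (h : IsIrrep ρ o₁ o₂) (hW : IsU2Component ρ W I Y) (A B C U V : ℂ) {w : E} (hw : w ∈ W) :
    act ρ (Omega3 A B C U V) w =
      (U * C3 o₁ o₂ +
        ((3 / 2) * (U - B) * C2 o₁ o₂ +
          (1 / 2) * (2 * A + B - 3 * U) * (I * (I + 1)) +
          (1 / 8) * (3 * B - 2 * C - U) * (Y : ℂ) ^ 2) * Y +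
        (1 / 2) * (U - V) * Y) • w := by
  have hr := isMatrixUnits_unit
  obtain ⟨v, hvW, hv0, hE, hH, hY⟩ := hW.highest
  rw [ladder_one_two] at hE
  rw [L_three] at hH
  rw [sqrt_three_smul_L_eight, map_smul, LinearMap.smul_apply] at hY
  -- Since √3 L₈ = -3e₂₂ acts as 3Y, e₂₂ acts as -Y; this explains the sign reversals from
  -- `Omega3_eq_casimir` to the eigenvalue.
  have hZ : act ρ (unit 2 2) w = (-Y : ℂ) • w := by
    refine act_eq_smul_of_commutesWithU2 hW ((commutesWithU2_iff _).2 fun i j hij =>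
      hr.commutator_invariants hij 0) hvW hv0 ?_ hw
    change act ρ (unit 2 2) v = _
    linear_combination (norm := module) (-1 / 3 : ℂ) • hY
  -- On the highest weight vector H² + 2H with H = 2I gives 4I(I+1).
  have hC : act ρ (isospinCasimir unit) w = (4 * (I * (I + 1)) : ℂ) • w := by
    refine act_eq_smul_of_commutesWithU2 hW ((commutesWithU2_iff _).2 fun i j hij =>
      hr.commutator_isospinCasimir hij) hvW hv0 ?_ hw
    simp only [isospinCasimir, map_add, map_smul, map_mul, LinearMap.add_apply,
      LinearMap.smul_apply, Module.End.mul_apply, hH, hE, map_zero]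
    module
  rw [Omega3_eq_casimir]
  simp only [map_add, map_sub, map_smul, map_mul, LinearMap.add_apply, LinearMap.sub_apply,
    LinearMap.smul_apply, Module.End.mul_apply, hZ, hC, act_cubicCasimir h,
    act_quadraticCasimir h]
  module

end Representations

end

end SU3

theorem mainTheorem10 :
    -- the most general cubic element commuting with `U(2)`, with complex parameters
    (∀ z : SU3.Env,
      (z ∈ SU3.cubicElements ∧ SU3.CommutesWithU2 z) ↔
        ∃ A B C U V x α β γ : ℂ,
          z = SU3.Omega3 A B C U V + (9 * x) • SU3.Omega2 α β γ) ∧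
    -- real parameters: the formally self-adjoint elements
    (∀ z : SU3.Env,
      (z ∈ SU3.cubicElements ∧ SU3.CommutesWithU2 z ∧ SU3.adjoint z = z) ↔
        ∃ A B C U V x α β γ : ℝ,
          z = SU3.Omega3 A B C U V + (9 * x : ℂ) • SU3.Omega2 α β γ) ∧
    -- the eigenvalue on the `U(2)` component `(I, Y)` of the irrep `(o₁, o₂)`
    (∀ (E : Type*) [AddCommGroup E] [Module ℂ E] [FiniteDimensional ℂ E]
      (ρ : SU3.su3 →ₗ⁅ℝ⁆ Module.End ℂ E) (o₁ o₂ : ℕ) (W : Submodule ℂ E) (I Y : ℝ),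
      SU3.IsIrrep ρ o₁ o₂ → SU3.IsU2Component ρ W I Y →
      ∀ A B C U V : ℂ, ∀ w ∈ W,
        SU3.act ρ (SU3.Omega3 A B C U V) w =
          (U * SU3.C3 o₁ o₂ +
            ((3 / 2) * (U - B) * SU3.C2 o₁ o₂ +
              (1 / 2) * (2 * A + B - 3 * U) * (I * (I + 1)) +
              (1 / 8) * (3 * B - 2 * C - U) * (Y : ℂ) ^ 2) * Y +
            (1 / 2) * (U - V) * Y) • w) := by
  exact ⟨SU3.cubic_commutesWithU2_iff, SU3.cubic_commutesWithU2_selfAdjoint_iff,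
    fun E _ _ _ ρ o₁ o₂ W I Y h hW A B C U V w hw => SU3.act_Omega3 h hW A B C U V hw⟩
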